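/- **Setting.** A block $tx_0,\dots,tx_{n-1}$ ($n\ge 0$) of deterministic transactions acts on memory locations with values; $\mathrm{Storage}(\ell)$ is the value of location $\ell$ before the block. A transaction is a deterministic program that successively reads locations (and continues according to the values it gets), writes values to locations, and possibly ends; it need not terminate. The *sequential run* executes $tx_0$ to completion, then $tx_1$, and so on, where a read of $\ell$ returns the last value written to $\ell$ so far, or $\mathrm{Storage}(\ell)$ if there is none; what it persists is the set of pairs $(\ell,v)$ such that $\ell$ is written during the run and $v$ is the last value written to $\ell$. **Algorithm (Block-STM).** Any number of threads concurrently execute $\mathsf{run}()$ below. A concurrent run is an arbitrary interleaving of atomic operations: every access to a shared variable or to an entry of $data$ is one atomic operation, and so are $\mathsf{read}$, fetch-and-increment, $x\gets\min(x,j)$, and each read-and-update of one $status[j]$. A *version* is a pair $(j,i)$ (transaction index, incarnation number). Loops over sets run in arbitrary order. *Shared variables.* $data$: a map from pairs $(\ell,j)$ to entries, an entry being a pair $(i,v)$ or the marker ESTIMATE, initially empty; for each $j<n$: $W[j]$ (set of last written locations) $=\emptyset$, $R[j]$ (last read-set, pairs of a location and a version or $\bot$) $=\emptyset$, $status[j]=(0,\mathrm{READY})$,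 with possible statuses READY, EXECUTING, EXECUTED, ABORTING, and $dep[j]=\emptyset$, a set protected by a lock; counters $exec\_idx=val\_idx=dec\_cnt=active=0$; $done=\mathrm{false}$. * $\mathsf{read}(\ell,j)$: take the entry at $(\ell,k)$ with the largest $k<j$; if there is none return NOT_FOUND; if it is ESTIMATE return READ_ERROR with blocking transaction $k$; if it is $(i,v)$ return OK with version $(k,i)$ and value $v$. * $\mathsf{run}()$: $task\gets\bot$; while not $done$: if $task$ is an execution task, $task\gets\mathsf{try\_execute}(task)$; then if $task$ is a validation task, $task\gets\mathsf{needs\_reexecution}(task)$; then if $task=\bot$, $task\gets\mathsf{next\_task}()$. The thread *joins* when it leaves the loop. * $\mathsf{try\_execute}(j,i)$: run $tx_j$ with an initially empty write-set and read-set. A write is stored in the write-set (the latest value per location). A read of $\ell$ returns the value in the write-set, if there is one; otherwise call $\mathsf{read}(\ell,j)$: on NOT_FOUND add $(\ell,\bot)$ to the read-set and return $\mathrm{Storage}(\ell)$; on OK add ($\ell$, version) to the read-set and return the value; on READ_ERROR with blocking $b$ stop and call $\mathsf{add\_dependency}(j,b)$, then, if it returned false, start $\mathsf{try\_execute}(j,i)$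 again, and otherwise return $\bot$. If $tx_j$ ends: set $data[(\ell,j)]\gets(i,v)$ for each $(\ell,v)$ in the write-set, whose set of locations is $N$; load $P\gets W[j]$; remove $data[(\ell,j)]$ for each $\ell\in P\setminus N$; $W[j]\gets N$; $R[j]\gets$ read-set; return $\mathsf{finish\_execution}(j,i,[N\setminus P\ne\emptyset])$. * $\mathsf{add\_dependency}(j,b)$: holding the lock of $dep[b]$: if $status[b]$ is EXECUTED, return false; set the status of $tx_j$ to ABORTING; add $j$ to $dep[b]$. Then release the lock, $active\gets active-1$, return true. * $\mathsf{set\_ready}(k)$: $status[k]\gets(\text{incarnation number}+1,\mathrm{READY})$. * $\mathsf{finish\_execution}(j,i,new)$: set the status of $tx_j$ to EXECUTED; under its lock, swap $dep[j]$ with $\emptyset$, obtaining $D$; $\mathsf{set\_ready}(k)$ for each $k\in D$; if $D\neq\emptyset$, $exec\_idx\gets\min(exec\_idx,\min D)$ and then $dec\_cnt\gets dec\_cnt+1$. If $val\_idx>j$: if $new$, then $val\_idx\gets\min(val\_idx,j)$ and $dec\_cnt\gets dec\_cnt+1$; otherwise return the validation task $(j,i)$. Finally $active\gets active-1$, return $\bot$.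 * $\mathsf{needs\_reexecution}(j,i)$: load $R[j]$ and call $\mathsf{read}(\ell,j)$ for each $(\ell,u)\in R[j]$, until one of them *fails*, i.e. returns READ_ERROR, or NOT_FOUND although $u\ne\bot$, or OK with a version $\neq u$. If one fails and (atomically) $status[j]=(i,\mathrm{EXECUTED})$, then set it to $(i,\mathrm{ABORTING})$; load $W[j]$ and set $data[(\ell,j)]\gets$ ESTIMATE for each $\ell\in W[j]$; $\mathsf{set\_ready}(j)$; $val\_idx\gets\min(val\_idx,j+1)$; $dec\_cnt\gets dec\_cnt+1$; if $exec\_idx>j$ and $v\gets\mathsf{try\_incarnate}(j)\neq\bot$, return the execution task $v$. In all other cases $active\gets active-1$ (once), return $\bot$. * $\mathsf{try\_incarnate}(j)$: if $j<n$ and $status[j]=(i,\mathrm{READY})$ for some $i$, set it to $(i,\mathrm{EXECUTING})$ and return $(j,i)$; otherwise return $\bot$. * $\mathsf{next\_task}()$: if $val\_idx<exec\_idx$ (two reads), then: if $val\_idx\ge n$, call $\mathsf{check\_done}()$ and return $\bot$; $active\gets active+1$; $j\gets val\_idx$.fetch\_and\_increment; if $j<n$ and $status[j]=(i,\mathrm{EXECUTED})$,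 return the validation task $(j,i)$; otherwise $active\gets active-1$, return $\bot$. Else: if $exec\_idx\ge n$, call $\mathsf{check\_done}()$ and return $\bot$; $active\gets active+1$; $j\gets exec\_idx$.fetch\_and\_increment; if $v\gets\mathsf{try\_incarnate}(j)\ne\bot$, return the execution task $v$; otherwise $active\gets active-1$, return $\bot$. * $\mathsf{check\_done}()$: $o\gets dec\_cnt$; if, read in this order, $exec\_idx\ge n$, $val\_idx\ge n$, $active=0$ and $dec\_cnt=o$, then $done\gets\mathrm{true}$. * $\mathsf{snapshot}()$: for every location $\ell$ that has an entry in $data$, call $\mathsf{read}(\ell,n)$ and, if it returns OK with value $v$, add $(\ell,v)$ to the result, which is returned at the end. **Theorem.** In every concurrent run, once some thread has joined, the sequential run of $tx_0,\dots,tx_{n-1}$ terminates, and every call to $\mathsf{snapshot}()$ made after that (possibly while other threads are still taking steps) returns, after enough steps of its caller, exactly the set of pairs $(\ell,v)$ that the sequential run persists. -/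

import Mathlib

namespace BlockSTM

/-! ### Transactions and the sequential run -/

/-- What a transaction does next: it ends, it writes `v` at location `l`, or it reads location `l`
and continues according to the value that it gets. -/
inductive Op (L V C : Type*) where
  | ret : Op L V C
  | write (l : L) (v : V) (next : C) : Op L V C
  | read (l : L) (next : V → C) : Op L V C

/-- `Exec vm storage c M M'`: run alone on a memory `storage` that is overlaid with the writes `M`,
the deterministic transaction in configuration `c` terminates and leaves the overlay `M'`.
A transaction need not terminate. -/
inductive Exec {L V C : Type*} [DecidableEq L] (vm : C → Op L V C) (storage : L → V) :
    C → (L → Option V) → (L → Option V) → Prop where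
  | ret (c : C) (M : L → Option V) (h : vm c = .ret) : Exec vm storage c M M
  | write (c c' : C) (l : L) (v : V) (M M' : L → Option V) (h : vm c = .write l v c')
      (hr : Exec vm storage c' (Function.update M l (some v)) M') : Exec vm storage c M M'
  | read (c : C) (l : L) (k : V → C) (M M' : L → Option V) (h : vm c = .read l k)
      (hr : Exec vm storage (k ((M l).getD (storage l))) M M') : Exec vm storage c M M'

/-- The sequential run of a list of transactions, each executed to completion before the next one
starts. `M l = some v` means that `l` has been written and that the last value written is `v`. -/
inductive SeqRun {L V C : Type*} [DecidableEq L] (vm : C → Op L V C) (storage : L → V) :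
    List C → (L → Option V) → (L → Option V) → Prop where
  | nil (M : L → Option V) : SeqRun vm storage [] M M
  | cons (c : C) (cs : List C) (M M' M'' : L → Option V) (h : Exec vm storage c M M')
      (hr : SeqRun vm storage cs M' M'') : SeqRun vm storage (c :: cs) M M''

/-! ### Shared state -/

/-- A pair (transaction index, incarnation number). -/
abbrev Version := ℕ × ℕ

/-- An entry of the multi-version data structure. -/
inductive Entry (V : Type*) where
  | estimate : Entry V
  | value (inc : ℕ) (v : V) : Entry V

inductive Status where
  | readyToExecute
  | executing
  | executed
  | aborting

inductive Task where
  | execution (v : Version)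
  | validation (v : Version)

/-- The variables of the modules `MVMemory` and `Scheduler`. A transaction status is accessed only
in critical sections that consist of a single read-modify-write, so the status locks are absorbed
into the atomicity of these operations; the lock of a dependency set is explicit, and
`depLock j = some t` means that thread `t` holds it. In a read-set `none` is the version `⊥` of a
value that was read from storage. -/
structure Shared (L V T : Type*) where
  data : L × ℕ → Option (Entry V)
  lastWritten : ℕ → Set L
  lastRead : ℕ → Set (L × Option Version)
  executionIdx : ℕ
  validationIdx : ℕ
  decreaseCnt : ℕ
  numActive : ℤ
  doneMarker : Bool
  txnDependency : ℕ → Set ℕ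
  depLock : ℕ → Option T
  txnStatus : ℕ → ℕ × Status

def Shared.init (L V T : Type*) : Shared L V T where
  data := fun _ => none
  lastWritten := fun _ => ∅
  lastRead := fun _ => ∅
  executionIdx := 0
  validationIdx := 0
  decreaseCnt := 0
  numActive := 0
  doneMarker := false
  txnDependency := fun _ => ∅
  depLock := fun _ => none
  txnStatus := fun _ => (0, .readyToExecute)

inductive ReadResult (V : Type*) where
  | notFound : ReadResult V
  | readError (blocking : ℕ) : ReadResult V
  | ok (version : Version) (v : V) : ReadResult V

/-- `MVMemory.read(l, j)`: looks up the entry at `l` with the highest transaction index `< j`. -/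
def mvRead {L V : Type*} (data : L × ℕ → Option (Entry V)) (l : L) : ℕ → ReadResult V
  | 0 => .notFound
  | j + 1 =>
    match data (l, j) with
    | none => mvRead data l j
    | some .estimate => .readError j
    | some (.value inc v) => .ok (j, inc) v

/-- The comparison that `validate_read_set` makes between a recorded version and a new read. -/
def readMatches {V : Type*} (recorded : Option Version) : ReadResult V → Prop
  | .notFound => recorded = none
  | .readError _ => False
  | .ok version _ => recorded = some version

/-! ### Threads -/

/-- Program counter of a thread, with the local variables that are still needed. `ws` is the
write-set and `rs` the read-set of the execution in progress; `todo` holds the elements that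
a loop still has to process, in an arbitrary order. -/
inductive PC (L V C : Type*) where
  -- the loop of `run`
  | loop (task : Option Task)
  | joined
  -- `try_execute`, with the virtual machine in configuration `c`
  | tryExecute (v : Version)
  | vmRun (v : Version) (c : C) (rs : Set (L × Option Version)) (ws : L → Option V)
  -- `add_dependency`, on the blocking transaction `b`
  | depAcquire (v : Version) (b : ℕ)
  | depCheck (v : Version) (b : ℕ)
  | depRetry (v : Version) (b : ℕ)
  | depAbort (v : Version) (b : ℕ)
  | depInsert (v : Version) (b : ℕ)
  | depRelease (v : Version) (b : ℕ)
  | depDecrement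
  -- `record`
  | applyWrites (v : Version) (rs : Set (L × Option Version)) (ws : L → Option V) (todo : Set L)
  | removeOld (v : Version) (rs : Set (L × Option Version)) (ws : L → Option V) (prev todo : Set L)
  | storeReads (v : Version) (rs : Set (L × Option Version)) (wroteNew : Prop)
  -- `finish_execution`
  | finStatus (v : Version) (wroteNew : Prop)
  | finSwap (v : Version) (wroteNew : Prop)
  | resume (v : Version) (wroteNew : Prop) (deps todo : Set ℕ)
  | resumeCount (v : Version) (wroteNew : Prop)
  | finCheck (v : Version) (wroteNew : Prop)
  | finDecreaseVal (v : Version)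
  | finCount
  | finDecrement
  -- `needs_reexecution`
  | valLoad (v : Version)
  | valReads (v : Version) (todo : Set (L × Option Version))
  | valTryAbort (v : Version)
  | convLoad (v : Version)
  | convert (v : Version) (todo : Set L)
  -- `finish_validation`
  | valSetReady (v : Version)
  | valDecreaseVal (v : Version)
  | valCount (v : Version)
  | valCheckExec (v : Version)
  | valIncarnate (v : Version)
  | valDecrement
  -- `next_task`
  | nextTask
  | nextCompare (observedVal : ℕ)
  -- `next_version_to_execute`
  | execBound
  | execIncrement
  | execFetch
  | execIncarnate (idx : ℕ)
  | execRevert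
  -- `next_version_to_validate`
  | valBound
  | valIncrement
  | valFetch
  | valStatus (idx : ℕ)
  | valRevert
  -- `check_done`
  | doneCount
  | doneExec (observed : ℕ)
  | doneVal (observed : ℕ)
  | doneActive (observed : ℕ)
  | doneRecount (observed : ℕ)
  | doneSet

/-- Where `run` continues when `try_execute` returns `task`: a validation task is performed in the
same iteration of the loop, and the absence of a task leads to `next_task`. -/
def afterExecution {L V C : Type*} : Option Task → PC L V C
  | none => .nextTask
  | some (.validation v) => .valLoad v
  | some (.execution v) => .loop (some (.execution v))

/-- Where `run` continues when `needs_reexecution` returns `task`. -/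
def afterValidation {L V C : Type*} : Option Task → PC L V C
  | none => .nextTask
  | some task => .loop (some task)

/-- `ThreadStep vm storage block t s p s' p'`: thread `t`, at program counter `p`, performs one
atomic operation, which changes the shared state from `s` to `s'`, and moves on to `p'`. -/
inductive ThreadStep {L V C T : Type*} [DecidableEq L] (vm : C → Op L V C) (storage : L → V)
    (block : List C) (t : T) : Shared L V T → PC L V C → Shared L V T → PC L V C → Prop where
  -- `run`
  | loop_done (s : Shared L V T) (task : Option Task) (h : s.doneMarker = true) :
      ThreadStep vm storage block t s (.loop task) s .joined
  | loop_execution (s : Shared L V T) (v : Version) (h : s.doneMarker = false) :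
      ThreadStep vm storage block t s (.loop (some (.execution v))) s (.tryExecute v)
  | loop_validation (s : Shared L V T) (v : Version) (h : s.doneMarker = false) :
      ThreadStep vm storage block t s (.loop (some (.validation v))) s (.valLoad v)
  | loop_none (s : Shared L V T) (h : s.doneMarker = false) :
      ThreadStep vm storage block t s (.loop none) s .nextTask
  -- `try_execute` and `VM.execute`
  | tryExecute (s : Shared L V T) (v : Version) (c : C) (h : block[v.1]? = some c) :
      ThreadStep vm storage block t s (.tryExecute v) s (.vmRun v c ∅ (fun _ => none))
  | vm_write (s : Shared L V T) (v : Version) (c c' : C) (rs : Set (L × Option Version))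
      (ws : L → Option V) (l : L) (x : V) (h : vm c = .write l x c') :
      ThreadStep vm storage block t s (.vmRun v c rs ws)
        s (.vmRun v c' rs (Function.update ws l (some x)))
  | vm_read_own (s : Shared L V T) (v : Version) (c : C) (rs : Set (L × Option Version))
      (ws : L → Option V) (l : L) (k : V → C) (x : V) (h : vm c = .read l k)
      (hw : ws l = some x) :
      ThreadStep vm storage block t s (.vmRun v c rs ws) s (.vmRun v (k x) rs ws)
  | vm_read_storage (s : Shared L V T) (v : Version) (c : C) (rs : Set (L × Option Version))
      (ws : L → Option V) (l : L) (k : V → C) (h : vm c = .read l k) (hw : ws l = none)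
      (hr : mvRead s.data l v.1 = .notFound) :
      ThreadStep vm storage block t s (.vmRun v c rs ws)
        s (.vmRun v (k (storage l)) (rs ∪ {(l, none)}) ws)
  | vm_read_ok (s : Shared L V T) (v : Version) (c : C) (rs : Set (L × Option Version))
      (ws : L → Option V) (l : L) (k : V → C) (u : Version) (x : V) (h : vm c = .read l k)
      (hw : ws l = none) (hr : mvRead s.data l v.1 = .ok u x) :
      ThreadStep vm storage block t s (.vmRun v c rs ws)
        s (.vmRun v (k x) (rs ∪ {(l, some u)}) ws)
  | vm_read_error (s : Shared L V T) (v : Version) (c : C) (rs : Set (L × Option Version))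
      (ws : L → Option V) (l : L) (k : V → C) (b : ℕ) (h : vm c = .read l k)
      (hw : ws l = none) (hr : mvRead s.data l v.1 = .readError b) :
      ThreadStep vm storage block t s (.vmRun v c rs ws) s (.depAcquire v b)
  | vm_ret (s : Shared L V T) (v : Version) (c : C) (rs : Set (L × Option Version))
      (ws : L → Option V) (h : vm c = .ret) :
      ThreadStep vm storage block t s (.vmRun v c rs ws)
        s (.applyWrites v rs ws {l | ws l ≠ none})
  -- `add_dependency`
  | dep_acquire (s : Shared L V T) (v : Version) (b : ℕ) (h : s.depLock b = none) :
      ThreadStep vm storage block t s (.depAcquire v b)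
        { s with depLock := Function.update s.depLock b (some t) } (.depCheck v b)
  | dep_check_executed (s : Shared L V T) (v : Version) (b : ℕ)
      (h : (s.txnStatus b).2 = .executed) :
      ThreadStep vm storage block t s (.depCheck v b) s (.depRetry v b)
  | dep_check_blocked (s : Shared L V T) (v : Version) (b : ℕ)
      (h : (s.txnStatus b).2 ≠ .executed) :
      ThreadStep vm storage block t s (.depCheck v b) s (.depAbort v b)
  | dep_retry (s : Shared L V T) (v : Version) (b : ℕ) :
      ThreadStep vm storage block t s (.depRetry v b)
        { s with depLock := Function.update s.depLock b none } (.tryExecute v)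
  | dep_abort (s : Shared L V T) (v : Version) (b : ℕ) :
      ThreadStep vm storage block t s (.depAbort v b)
        { s with txnStatus := Function.update s.txnStatus v.1 ((s.txnStatus v.1).1, .aborting) }
        (.depInsert v b)
  | dep_insert (s : Shared L V T) (v : Version) (b : ℕ) :
      ThreadStep vm storage block t s (.depInsert v b)
        { s with
          txnDependency := Function.update s.txnDependency b (s.txnDependency b ∪ {v.1}) }
        (.depRelease v b)
  | dep_release (s : Shared L V T) (v : Version) (b : ℕ) :
      ThreadStep vm storage block t s (.depRelease v b)
        { s with depLock := Function.update s.depLock b none } .depDecrement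
  | dep_decrement (s : Shared L V T) :
      ThreadStep vm storage block t s .depDecrement
        { s with numActive := s.numActive - 1 } (afterExecution none)
  -- `record`
  | apply_write (s : Shared L V T) (v : Version) (rs : Set (L × Option Version))
      (ws : L → Option V) (todo : Set L) (l : L) (x : V) (hl : l ∈ todo) (hx : ws l = some x) :
      ThreadStep vm storage block t s (.applyWrites v rs ws todo)
        { s with data := Function.update s.data (l, v.1) (some (.value v.2 x)) }
        (.applyWrites v rs ws (todo \ {l}))
  | apply_end (s : Shared L V T) (v : Version) (rs : Set (L × Option Version))
      (ws : L → Option V) :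
      ThreadStep vm storage block t s (.applyWrites v rs ws ∅)
        s (.removeOld v rs ws (s.lastWritten v.1) (s.lastWritten v.1 \ {l | ws l ≠ none}))
  | remove_old (s : Shared L V T) (v : Version) (rs : Set (L × Option Version))
      (ws : L → Option V) (prev todo : Set L) (l : L) (hl : l ∈ todo) :
      ThreadStep vm storage block t s (.removeOld v rs ws prev todo)
        { s with data := Function.update s.data (l, v.1) none }
        (.removeOld v rs ws prev (todo \ {l}))
  | remove_end (s : Shared L V T) (v : Version) (rs : Set (L × Option Version))
      (ws : L → Option V) (prev : Set L) :
      ThreadStep vm storage block t s (.removeOld v rs ws prev ∅)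
        { s with lastWritten := Function.update s.lastWritten v.1 {l | ws l ≠ none} }
        (.storeReads v rs ({l | ws l ≠ none} \ prev).Nonempty)
  | store_reads (s : Shared L V T) (v : Version) (rs : Set (L × Option Version))
      (wroteNew : Prop) :
      ThreadStep vm storage block t s (.storeReads v rs wroteNew)
        { s with lastRead := Function.update s.lastRead v.1 rs } (.finStatus v wroteNew)
  -- `finish_execution`, with `resume_dependencies`
  | fin_status (s : Shared L V T) (v : Version) (wroteNew : Prop) :
      ThreadStep vm storage block t s (.finStatus v wroteNew)
        { s with txnStatus := Function.update s.txnStatus v.1 ((s.txnStatus v.1).1, .executed) }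
        (.finSwap v wroteNew)
  | fin_swap (s : Shared L V T) (v : Version) (wroteNew : Prop) (h : s.depLock v.1 = none) :
      ThreadStep vm storage block t s (.finSwap v wroteNew)
        { s with txnDependency := Function.update s.txnDependency v.1 ∅ }
        (.resume v wroteNew (s.txnDependency v.1) (s.txnDependency v.1))
  | resume_ready (s : Shared L V T) (v : Version) (wroteNew : Prop) (deps todo : Set ℕ) (d : ℕ)
      (hd : d ∈ todo) :
      ThreadStep vm storage block t s (.resume v wroteNew deps todo)
        { s with
          txnStatus := Function.update s.txnStatus d ((s.txnStatus d).1 + 1, .readyToExecute) }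
        (.resume v wroteNew deps (todo \ {d}))
  | resume_none (s : Shared L V T) (v : Version) (wroteNew : Prop) :
      ThreadStep vm storage block t s (.resume v wroteNew ∅ ∅) s (.finCheck v wroteNew)
  | resume_decrease (s : Shared L V T) (v : Version) (wroteNew : Prop) (deps : Set ℕ) (m : ℕ)
      (hm : IsLeast deps m) :
      ThreadStep vm storage block t s (.resume v wroteNew deps ∅)
        { s with executionIdx := min s.executionIdx m } (.resumeCount v wroteNew)
  | resume_count (s : Shared L V T) (v : Version) (wroteNew : Prop) :
      ThreadStep vm storage block t s (.resumeCount v wroteNew)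
        { s with decreaseCnt := s.decreaseCnt + 1 } (.finCheck v wroteNew)
  | fin_check_new (s : Shared L V T) (v : Version) (wroteNew : Prop)
      (h : s.validationIdx > v.1) (hw : wroteNew) :
      ThreadStep vm storage block t s (.finCheck v wroteNew) s (.finDecreaseVal v)
  | fin_check_task (s : Shared L V T) (v : Version) (wroteNew : Prop)
      (h : s.validationIdx > v.1) (hw : ¬ wroteNew) :
      ThreadStep vm storage block t s (.finCheck v wroteNew)
        s (afterExecution (some (.validation v)))
  | fin_check_small (s : Shared L V T) (v : Version) (wroteNew : Prop)
      (h : ¬ s.validationIdx > v.1) :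
      ThreadStep vm storage block t s (.finCheck v wroteNew) s .finDecrement
  | fin_decrease_val (s : Shared L V T) (v : Version) :
      ThreadStep vm storage block t s (.finDecreaseVal v)
        { s with validationIdx := min s.validationIdx v.1 } .finCount
  | fin_count (s : Shared L V T) :
      ThreadStep vm storage block t s .finCount
        { s with decreaseCnt := s.decreaseCnt + 1 } .finDecrement
  | fin_decrement (s : Shared L V T) :
      ThreadStep vm storage block t s .finDecrement
        { s with numActive := s.numActive - 1 } (afterExecution none)
  -- `needs_reexecution`
  | val_load (s : Shared L V T) (v : Version) :
      ThreadStep vm storage block t s (.valLoad v) s (.valReads v (s.lastRead v.1))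
  | val_read_match (s : Shared L V T) (v : Version) (todo : Set (L × Option Version)) (l : L)
      (u : Option Version) (hl : (l, u) ∈ todo) (h : readMatches u (mvRead s.data l v.1)) :
      ThreadStep vm storage block t s (.valReads v todo) s (.valReads v (todo \ {(l, u)}))
  | val_read_mismatch (s : Shared L V T) (v : Version) (todo : Set (L × Option Version)) (l : L)
      (u : Option Version) (hl : (l, u) ∈ todo) (h : ¬ readMatches u (mvRead s.data l v.1)) :
      ThreadStep vm storage block t s (.valReads v todo) s (.valTryAbort v)
  | val_read_end (s : Shared L V T) (v : Version) :
      ThreadStep vm storage block t s (.valReads v ∅) s .valDecrement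
  | val_abort (s : Shared L V T) (v : Version) (h : s.txnStatus v.1 = (v.2, .executed)) :
      ThreadStep vm storage block t s (.valTryAbort v)
        { s with txnStatus := Function.update s.txnStatus v.1 (v.2, .aborting) } (.convLoad v)
  | val_no_abort (s : Shared L V T) (v : Version) (h : s.txnStatus v.1 ≠ (v.2, .executed)) :
      ThreadStep vm storage block t s (.valTryAbort v) s .valDecrement
  | conv_load (s : Shared L V T) (v : Version) :
      ThreadStep vm storage block t s (.convLoad v) s (.convert v (s.lastWritten v.1))
  | convert_one (s : Shared L V T) (v : Version) (todo : Set L) (l : L) (hl : l ∈ todo) :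
      ThreadStep vm storage block t s (.convert v todo)
        { s with data := Function.update s.data (l, v.1) (some .estimate) }
        (.convert v (todo \ {l}))
  | convert_end (s : Shared L V T) (v : Version) :
      ThreadStep vm storage block t s (.convert v ∅) s (.valSetReady v)
  -- `finish_validation` after a successful abort
  | val_set_ready (s : Shared L V T) (v : Version) :
      ThreadStep vm storage block t s (.valSetReady v)
        { s with
          txnStatus :=
            Function.update s.txnStatus v.1 ((s.txnStatus v.1).1 + 1, .readyToExecute) }
        (.valDecreaseVal v)
  | val_decrease_val (s : Shared L V T) (v : Version) :
      ThreadStep vm storage block t s (.valDecreaseVal v)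
        { s with validationIdx := min s.validationIdx (v.1 + 1) } (.valCount v)
  | val_count (s : Shared L V T) (v : Version) :
      ThreadStep vm storage block t s (.valCount v)
        { s with decreaseCnt := s.decreaseCnt + 1 } (.valCheckExec v)
  | val_check_exec_large (s : Shared L V T) (v : Version) (h : s.executionIdx > v.1) :
      ThreadStep vm storage block t s (.valCheckExec v) s (.valIncarnate v)
  | val_check_exec_small (s : Shared L V T) (v : Version) (h : ¬ s.executionIdx > v.1) :
      ThreadStep vm storage block t s (.valCheckExec v) s .valDecrement
  -- `try_incarnate` called from `finish_validation`: when it fails, the validation task is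
  -- finished, and `numActive` is decremented once for it
  | val_incarnate (s : Shared L V T) (v : Version) (i : ℕ) (hb : v.1 < block.length)
      (h : s.txnStatus v.1 = (i, .readyToExecute)) :
      ThreadStep vm storage block t s (.valIncarnate v)
        { s with txnStatus := Function.update s.txnStatus v.1 (i, .executing) }
        (afterValidation (some (.execution (v.1, i))))
  | val_no_incarnate (s : Shared L V T) (v : Version)
      (h : ¬ (v.1 < block.length ∧ (s.txnStatus v.1).2 = .readyToExecute)) :
      ThreadStep vm storage block t s (.valIncarnate v) s .valDecrement
  | val_decrement (s : Shared L V T) :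
      ThreadStep vm storage block t s .valDecrement
        { s with numActive := s.numActive - 1 } (afterValidation none)
  -- `next_task`
  | next_task (s : Shared L V T) :
      ThreadStep vm storage block t s .nextTask s (.nextCompare s.validationIdx)
  | next_validation (s : Shared L V T) (x : ℕ) (h : x < s.executionIdx) :
      ThreadStep vm storage block t s (.nextCompare x) s .valBound
  | next_execution (s : Shared L V T) (x : ℕ) (h : ¬ x < s.executionIdx) :
      ThreadStep vm storage block t s (.nextCompare x) s .execBound
  -- `next_version_to_execute`, with `try_incarnate`
  | exec_bound_done (s : Shared L V T) (h : s.executionIdx ≥ block.length) :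
      ThreadStep vm storage block t s .execBound s .doneCount
  | exec_bound (s : Shared L V T) (h : ¬ s.executionIdx ≥ block.length) :
      ThreadStep vm storage block t s .execBound s .execIncrement
  | exec_increment (s : Shared L V T) :
      ThreadStep vm storage block t s .execIncrement
        { s with numActive := s.numActive + 1 } .execFetch
  | exec_fetch (s : Shared L V T) :
      ThreadStep vm storage block t s .execFetch
        { s with executionIdx := s.executionIdx + 1 } (.execIncarnate s.executionIdx)
  | exec_incarnate (s : Shared L V T) (j i : ℕ) (hb : j < block.length)
      (h : s.txnStatus j = (i, .readyToExecute)) :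
      ThreadStep vm storage block t s (.execIncarnate j)
        { s with txnStatus := Function.update s.txnStatus j (i, .executing) }
        (.loop (some (.execution (j, i))))
  | exec_no_incarnate (s : Shared L V T) (j : ℕ)
      (h : ¬ (j < block.length ∧ (s.txnStatus j).2 = .readyToExecute)) :
      ThreadStep vm storage block t s (.execIncarnate j) s .execRevert
  | exec_revert (s : Shared L V T) :
      ThreadStep vm storage block t s .execRevert
        { s with numActive := s.numActive - 1 } (.loop none)
  -- `next_version_to_validate`
  | val_bound_done (s : Shared L V T) (h : s.validationIdx ≥ block.length) :
      ThreadStep vm storage block t s .valBound s .doneCount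
  | val_bound (s : Shared L V T) (h : ¬ s.validationIdx ≥ block.length) :
      ThreadStep vm storage block t s .valBound s .valIncrement
  | val_increment (s : Shared L V T) :
      ThreadStep vm storage block t s .valIncrement
        { s with numActive := s.numActive + 1 } .valFetch
  | val_fetch (s : Shared L V T) :
      ThreadStep vm storage block t s .valFetch
        { s with validationIdx := s.validationIdx + 1 } (.valStatus s.validationIdx)
  | val_status (s : Shared L V T) (j i : ℕ) (hb : j < block.length)
      (h : s.txnStatus j = (i, .executed)) :
      ThreadStep vm storage block t s (.valStatus j) s (.loop (some (.validation (j, i))))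
  | val_status_none (s : Shared L V T) (j : ℕ)
      (h : ¬ (j < block.length ∧ (s.txnStatus j).2 = .executed)) :
      ThreadStep vm storage block t s (.valStatus j) s .valRevert
  | val_revert (s : Shared L V T) :
      ThreadStep vm storage block t s .valRevert
        { s with numActive := s.numActive - 1 } (.loop none)
  -- `check_done`
  | done_count (s : Shared L V T) :
      ThreadStep vm storage block t s .doneCount s (.doneExec s.decreaseCnt)
  | done_exec (s : Shared L V T) (o : ℕ) (h : s.executionIdx ≥ block.length) :
      ThreadStep vm storage block t s (.doneExec o) s (.doneVal o)
  | done_exec_fail (s : Shared L V T) (o : ℕ) (h : ¬ s.executionIdx ≥ block.length) :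
      ThreadStep vm storage block t s (.doneExec o) s (.loop none)
  | done_val (s : Shared L V T) (o : ℕ) (h : s.validationIdx ≥ block.length) :
      ThreadStep vm storage block t s (.doneVal o) s (.doneActive o)
  | done_val_fail (s : Shared L V T) (o : ℕ) (h : ¬ s.validationIdx ≥ block.length) :
      ThreadStep vm storage block t s (.doneVal o) s (.loop none)
  | done_active (s : Shared L V T) (o : ℕ) (h : s.numActive = 0) :
      ThreadStep vm storage block t s (.doneActive o) s (.doneRecount o)
  | done_active_fail (s : Shared L V T) (o : ℕ) (h : s.numActive ≠ 0) :
      ThreadStep vm storage block t s (.doneActive o) s (.loop none)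
  | done_recount (s : Shared L V T) (o : ℕ) (h : o = s.decreaseCnt) :
      ThreadStep vm storage block t s (.doneRecount o) s .doneSet
  | done_recount_fail (s : Shared L V T) (o : ℕ) (h : o ≠ s.decreaseCnt) :
      ThreadStep vm storage block t s (.doneRecount o) s (.loop none)
  | done_set (s : Shared L V T) :
      ThreadStep vm storage block t s .doneSet { s with doneMarker := true } (.loop none)

/-! ### Concurrent runs -/

/-- State of a call to `MVMemory.snapshot()`: not made yet; in progress, with the locations that
the loop still has to process and the pairs collected so far; or returned. -/
inductive Client (L V : Type*) where
  | idle
  | running (todo : Set L) (ret : Set (L × V))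
  | returned (ret : Set (L × V))

structure State (L V C T : Type*) where
  shared : Shared L V T
  pc : T → PC L V C
  client : Client L V

def State.init (L V C T : Type*) : State L V C T where
  shared := Shared.init L V T
  pc := fun _ => .loop none
  client := .idle

/-- One atomic operation of the caller of `MVMemory.snapshot()` in a block of `n` transactions. The
call is made at any time after some thread has joined, and by anyone. -/
inductive ClientStep {L V C T : Type*} (n : ℕ) : State L V C T → State L V C T → Prop where
  | call (s : State L V C T) (t : T) (ht : s.pc t = .joined) (h : s.client = .idle) :
      ClientStep n s
        { s with client := .running {l | ∃ i, s.shared.data (l, i) ≠ none} ∅ }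
  | collect (s : State L V C T) (todo : Set L) (ret : Set (L × V)) (l : L) (u : Version) (x : V)
      (h : s.client = .running todo ret) (hl : l ∈ todo)
      (hr : mvRead s.shared.data l n = .ok u x) :
      ClientStep n s { s with client := .running (todo \ {l}) (ret ∪ {(l, x)}) }
  | skip (s : State L V C T) (todo : Set L) (ret : Set (L × V)) (l : L)
      (h : s.client = .running todo ret) (hl : l ∈ todo)
      (hr : ∀ u x, mvRead s.shared.data l n ≠ .ok u x) :
      ClientStep n s { s with client := .running (todo \ {l}) ret }
  | finish (s : State L V C T) (ret : Set (L × V)) (h : s.client = .running ∅ ret) :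
      ClientStep n s { s with client := .returned ret }

/-- One atomic operation of a concurrent run, performed by a thread or by the caller of
`MVMemory.snapshot()`. -/
inductive Step {L V C T : Type*} [DecidableEq L] [DecidableEq T] (vm : C → Op L V C)
    (storage : L → V) (block : List C) : State L V C T → State L V C T → Prop where
  | thread (s : State L V C T) (t : T) (sh : Shared L V T) (p : PC L V C)
      (h : ThreadStep vm storage block t s.shared (s.pc t) sh p) :
      Step vm storage block s { s with shared := sh, pc := Function.update s.pc t p }
  | client (s s' : State L V C T) (h : ClientStep block.length s s') :
      Step vm storage block s s'

/-- The states that occur in concurrent runs, under all interleavings. -/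
def Reachable {L V C T : Type*} [DecidableEq L] [DecidableEq T] (vm : C → Op L V C)
    (storage : L → V) (block : List C) (s : State L V C T) : Prop :=
  Relation.ReflTransGen (Step vm storage block) (State.init L V C T) s

end BlockSTM

/-!
The proof follows four invariants of the shared state and the program counters through all atomic
steps, and evaluates them in a state in which no thread has a task.

*End of the block* (`DoneInv`). `numActive` counts the threads that have a task or fetch one. Every
decrease of an index is counted in `decreaseCnt` before its thread becomes inactive. So if
`check_done` sees both indices beyond the block, then `numActive = 0`, and then an unchanged
`decreaseCnt`, both indices were beyond the block at the moment when no thread was active. Such a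
state is `Quiet`, quietness is stable, and in quiet states the multi-version data is frozen
(`Quiet.step`).

*Responsibilities and columns* (`OwnInv`). Two ghost variables are used. `owner j` says who is
responsible for transaction `j`: nobody if it is ready or executed, otherwise one thread or the set
of dependencies of another transaction. The history `H j i` is the write-set of incarnation `i` of
transaction `j`. The column of `j` in the multi-version data consists of estimates at the last
written locations until an incarnation ends, and equals `H j i` once `(i, executed)` is its status.
The read-set explains the write-set (`Finished`): on every memory that agrees with the recorded
reads, the transaction terminates and writes exactly `H j i`. This is formulated by continuations
(`Explains`), so that traces of executions need not be represented.

*Progress of executions* (`ExecInv`). A ready transaction is ahead of `executionIdx`, or some thread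
will make it so. A transaction that waits for `b` is larger than `b`, and `b` is not executed or is
about to resume its dependencies; the lock of the dependencies is what makes this hold. In a quiet
state it follows by strong induction that all transactions are executed
(`OwnInv.executed_of_quiet`).

*Progress of validations* (`ValInv`). All recorded reads of an executed transaction are up to date,
or it is ahead of `validationIdx`, or some thread will lower this index below it, or some thread
will validate the current incarnation. The point is that recorded reads only go out of date through
writes to new locations and through estimates, and both are followed by a decrease of
`validationIdx`; all other writes replace estimates, on which no up-to-date read relies
(`OwnInv.mismatches_step`).

In a quiet state, therefore, each transaction, run alone on the values of the transactions below it,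
writes the values in its own column (`OwnInv.exec_of_quiet`), and these executions form the
sequential run. The data is frozen, so a snapshot collects precisely the final values
(`ClientInv.step`), and it ends since only finitely many locations have entries.
-/

namespace BlockSTM

variable {L V C T : Type*}

/-! ### Detection of the end of the block -/

/-- The thread is counted in `numActive`: it has a task, or it is fetching one. -/
def PC.active : PC L V C → Prop
  | .loop none | .joined | .nextTask | .nextCompare _ | .execBound | .execIncrement | .valBound
  | .valIncrement | .doneCount | .doneExec _ | .doneVal _ | .doneActive _ | .doneRecount _
  | .doneSet => False
  | _ => True

/-- The thread has no task, and if it is fetching one from an index that is at least `n`, it will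
not get one. -/
def PC.quiet (n : ℕ) : PC L V C → Prop
  | .execFetch | .execRevert | .valFetch | .valRevert => True
  | .execIncarnate j | .valStatus j => n ≤ j
  | p => ¬ p.active

/-- The thread has decreased an index and has not yet increased `decreaseCnt`. -/
def PC.counting : PC L V C → Prop
  | .resumeCount _ _ | .finCount | .valCount _ => True
  | _ => False

/-- Both indices have passed the block of `n` transactions, and no thread has a task. This is
stable, and nothing is written to the multi-version data structure any more. -/
structure Quiet (n : ℕ) (s : Shared L V T) (pc : T → PC L V C) : Prop where
  exec : n ≤ s.executionIdx
  val : n ≤ s.validationIdx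
  quiet : ∀ t, (pc t).quiet n

/-- Since `decreaseCnt` was `o`, it has been increased, or some thread is about to do so. -/
def Unsettled (s : Shared L V T) (pc : T → PC L V C) (o : ℕ) : Prop :=
  o < s.decreaseCnt ∨ ∃ t, (pc t).counting

/-- What the tests that `check_done` has already passed guarantee. -/
def CheckInv (n : ℕ) (s : Shared L V T) (pc : T → PC L V C) : PC L V C → Prop
  | .doneExec o => o ≤ s.decreaseCnt
  | .doneVal o => o ≤ s.decreaseCnt ∧ (Unsettled s pc o ∨ n ≤ s.executionIdx)
  | .doneActive o =>
    o ≤ s.decreaseCnt ∧ (Unsettled s pc o ∨ n ≤ s.executionIdx ∧ n ≤ s.validationIdx)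
  | .doneRecount o => o ≤ s.decreaseCnt ∧ (o < s.decreaseCnt ∨ Quiet n s pc)
  | .doneSet => Quiet n s pc
  | .joined => s.doneMarker = true
  | _ => True

/-- `numActive` is the number of active threads, the threads in `check_done` know what their tests
have shown, and `doneMarker` is only set when all work has been done. -/
structure DoneInv (n : ℕ) (s : Shared L V T) (pc : T → PC L V C) : Prop where
  count : ∃ F : Finset T, (∀ t, t ∈ F ↔ (pc t).active) ∧ s.numActive = F.card
  check : ∀ t, CheckInv n s pc (pc t)
  done : s.doneMarker = true → Quiet n s pc

theorem PC.quiet_of_not_active (n : ℕ) {p : PC L V C} (h : ¬ p.active) : p.quiet n := by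
  cases p <;> first | exact h | exact absurd trivial h

theorem PC.active_of_counting {p : PC L V C} (h : p.counting) : p.active := by
  cases p <;> first | exact h.elim | exact trivial

variable [DecidableEq L] {vm : C → Op L V C} {storage : L → V} {block : List C}
  {t : T} {s s' : Shared L V T} {p p' : PC L V C} {pc : T → PC L V C}

/-- Every step changes `numActive` according to whether the thread becomes active or inactive. A
thread that joins with a task would be an exception, but `doneMarker` is not set as long as there
are tasks. -/
theorem ThreadStep.numActive_eq (h : ThreadStep vm storage block t s p s' p')
    (hd : s.doneMarker = true → p.quiet block.length) :
    ((p'.active ↔ p.active) ∧ s'.numActive = s.numActive) ∨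
      (¬ p.active ∧ p'.active ∧ s'.numActive = s.numActive + 1) ∨
      (p.active ∧ ¬ p'.active ∧ s'.numActive = s.numActive - 1) := by
  cases h with
  | loop_done task h =>
    have := hd h
    rcases task with _ | _ <;> simp_all [PC.active, PC.quiet]
  | _ => simp [PC.active, afterExecution, afterValidation]

theorem ThreadStep.decreaseCnt_le (h : ThreadStep vm storage block t s p s' p') :
    s.decreaseCnt ≤ s'.decreaseCnt ∧ (p.counting → s.decreaseCnt < s'.decreaseCnt) := by
  cases h <;> simp [PC.counting]

theorem ThreadStep.executionIdx_le (h : ThreadStep vm storage block t s p s' p') :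
    s.executionIdx ≤ s'.executionIdx ∨ p'.counting := by
  cases h <;> simp [PC.counting]

theorem ThreadStep.validationIdx_le (h : ThreadStep vm storage block t s p s' p') :
    s.validationIdx ≤ s'.validationIdx ∨ p'.counting := by
  cases h <;> simp [PC.counting]

/-- What a thread without a task can do once both indices have passed the block. -/
theorem ThreadStep.of_quiet (h : ThreadStep vm storage block t s p s' p')
    (he : block.length ≤ s.executionIdx) (hv : block.length ≤ s.validationIdx)
    (hp : p.quiet block.length) :
    block.length ≤ s'.executionIdx ∧ block.length ≤ s'.validationIdx ∧
      p'.quiet block.length ∧ s'.data = s.data := by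
  cases h with
  | exec_incarnate j i hb h => exact absurd hb (not_lt.2 hp)
  | val_status j i hb h => exact absurd hb (not_lt.2 hp)
  | loop_done task h => exact ⟨he, hv, not_false, rfl⟩
  | _ =>
    first
    | exact absurd trivial hp
    | (simp only [PC.quiet, PC.active, and_true, not_false_eq_true]; omega)

/-- The test that a thread passes in `check_done` guarantees what the next test relies on. -/
theorem DoneInv.check_next (hi : DoneInv block.length s pc)
    (h : ThreadStep vm storage block t s (pc t) s' p') : CheckInv block.length s pc p' := by
  have hc := hi.check t
  generalize pc t = p at h hc
  cases h with
  | loop_done task h => exact h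
  | done_count => exact le_refl s.decreaseCnt
  | done_exec o h => exact ⟨hc, .inr h⟩
  | done_val o h => exact ⟨hc.1, hc.2.imp_right fun he => ⟨he, h⟩⟩
  | done_active o h =>
    -- When `numActive` is zero, no thread is between a decrease and its count.
    obtain ⟨F, hF, hcard⟩ := hi.count
    have hempty : ∀ v, ¬ (pc v).active := fun v hv => by
      have : F.card = 0 := by rw [h] at hcard; exact_mod_cast hcard.symm
      rw [Finset.card_eq_zero] at this
      simpa [this] using (hF v).2 hv
    rcases hc with ⟨ho, (hlt | ⟨u, hu⟩) | ⟨he, hv⟩⟩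
    · exact ⟨ho, .inl hlt⟩
    · exact absurd (PC.active_of_counting hu) (hempty u)
    · exact ⟨ho, .inr ⟨he, hv, fun u => PC.quiet_of_not_active _ (hempty u)⟩⟩
  | done_recount o h => exact hc.2.resolve_left (by omega)
  | _ => trivial

variable [DecidableEq T]

theorem Quiet.step (hq : Quiet block.length s pc)
    (h : ThreadStep vm storage block t s (pc t) s' p') :
    Quiet block.length s' (Function.update pc t p') ∧ s'.data = s.data := by
  obtain ⟨he, hv, hp, hd⟩ := h.of_quiet hq.exec hq.val (hq.quiet t)
  refine ⟨⟨he, hv, fun u => ?_⟩, hd⟩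
  by_cases hu : u = t
  · subst hu; simpa using hp
  · simpa [hu] using hq.quiet u

theorem Unsettled.step {o : ℕ} (hu : Unsettled s pc o) (ho : o ≤ s.decreaseCnt)
    (h : ThreadStep vm storage block t s (pc t) s' p') :
    Unsettled s' (Function.update pc t p') o := by
  obtain ⟨h1, h2⟩ := h.decreaseCnt_le
  rcases hu with hu | ⟨u, hu⟩
  · exact .inl (hu.trans_le h1)
  · by_cases hut : u = t
    · subst hut; exact .inl (ho.trans_lt (h2 hu))
    · exact .inr ⟨u, by simpa [hut] using hu⟩

theorem CheckInv.step {q : PC L V C} (hc : CheckInv block.length s pc q)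
    (h : ThreadStep vm storage block t s (pc t) s' p') :
    CheckInv block.length s' (Function.update pc t p') q := by
  have h1 := h.decreaseCnt_le.1
  have hcnt : p'.counting → ∃ u, (Function.update pc t p' u).counting := fun hp =>
    ⟨t, by simpa using hp⟩
  cases q with
  | doneExec o => exact le_trans hc h1
  | doneVal o =>
    refine ⟨hc.1.trans h1, hc.2.elim (fun hu => .inl (hu.step hc.1 h)) fun he => ?_⟩
    exact h.executionIdx_le.elim (fun h => .inr (he.trans h)) fun h => .inl (.inr (hcnt h))
  | doneActive o =>
    refine ⟨hc.1.trans h1, hc.2.elim (fun hu => .inl (hu.step hc.1 h)) fun he => ?_⟩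
    rcases h.executionIdx_le with hx | hx
    · rcases h.validationIdx_le with hy | hy
      · exact .inr ⟨he.1.trans hx, he.2.trans hy⟩
      · exact .inl (.inr (hcnt hy))
    · exact .inl (.inr (hcnt hx))
  | doneRecount o =>
    exact ⟨hc.1.trans h1, hc.2.imp (fun h => h.trans_le h1) fun hq => (hq.step h).1⟩
  | doneSet => exact (Quiet.step hc h).1
  | joined =>
    generalize pc t = p at h
    cases h <;> first | exact hc | rfl
  | _ => trivial

theorem DoneInv.step (hi : DoneInv block.length s pc)
    (h : ThreadStep vm storage block t s (pc t) s' p') :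
    DoneInv block.length s' (Function.update pc t p') := by
  obtain ⟨F, hF, hcard⟩ := hi.count
  refine ⟨?_, fun u => ?_, fun hd => ?_⟩
  · rcases h.numActive_eq fun hd => (hi.done hd).quiet t with ⟨ha, hn⟩ | ⟨h1, h2, hn⟩ | ⟨h1, h2, hn⟩
    · refine ⟨F, fun u => ?_, by rw [hn, hcard]⟩
      by_cases hu : u = t
      · subst hu; simp [hF, ha]
      · simp [hu, hF]
    · refine ⟨insert t F, fun u => ?_, ?_⟩
      · by_cases hu : u = t
        · subst hu; simp [h2]
        · simp [hu, hF]
      · rw [Finset.card_insert_of_notMem (by rw [hF]; exact h1), hn, hcard]; simp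
    · refine ⟨F.erase t, fun u => ?_, ?_⟩
      · by_cases hu : u = t
        · subst hu; simp [h2]
        · simp [hu, hF]
      · have ht : t ∈ F := (hF t).2 h1
        have := Finset.card_erase_add_one ht
        omega
  · by_cases hu : u = t
    · subst hu; rw [Function.update_self]; exact (hi.check_next h).step h
    · rw [Function.update_of_ne hu]; exact (hi.check u).step h
  · by_cases hs : s.doneMarker = true
    · exact ((hi.done hs).step h).1
    · have hq : Quiet block.length s pc := by
        have hc := hi.check t
        generalize pc t = p at h hc
        cases h <;> first | exact absurd hd hs | exact hc
      exact (hq.step h).1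

end BlockSTM

namespace BlockSTM

variable {L V C T : Type*}

/-! ### Ownership of transactions and the columns of the multi-version data structure -/

/-- The part of the shared state that belongs to one transaction: its status, its entries in the
multi-version data structure, and its last written locations and last read-set. -/
structure View (L V : Type*) where
  status : ℕ × Status
  col : L → Option (Entry V)
  written : Set L
  reads : Set (L × Option Version)

def Shared.view (s : Shared L V T) (j : ℕ) : View L V :=
  ⟨s.txnStatus j, fun l => s.data (l, j), s.lastWritten j, s.lastRead j⟩

/-- The writes recorded by the versions of all transactions: `H j i` is the write-set of the
incarnation `i` of transaction `j`, and it is empty as long as this incarnation has not ended. -/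
abbrev History (L V : Type*) := ℕ → ℕ → L → Option V

/-- The memory `M` overlaid with the write-set `ws`. -/
def overlay (ws M : L → Option V) (l : L) : Option V := (ws l).or (M l)

/-- Running on the memory `M`, the reads of the read-set `rs` return what the recorded versions
have written. -/
def ReadsFrom (H : History L V) (rs : Set (L × Option Version)) (M : L → Option V) : Prop :=
  ∀ l u, (l, u) ∈ rs → M l = u.bind fun v => H v.1 v.2 l

/-- The versions in the read-set `rs` have written the locations at which they have been read. -/
def Recorded (H : History L V) (rs : Set (L × Option Version)) : Prop :=
  ∀ l (v : Version), (l, some v) ∈ rs → ∃ x, H v.1 v.2 l = some x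

/-- An execution of `c₀` that has reached `c` with the read-set `rs` and the write-set `ws`: on
every memory that agrees with the read-set, the execution alone would also reach this point. -/
def Explains [DecidableEq L] (vm : C → Op L V C) (storage : L → V) (H : History L V) (c₀ c : C)
    (rs : Set (L × Option Version)) (ws : L → Option V) : Prop :=
  Recorded H rs ∧ ∀ M M', ReadsFrom H rs M → Exec vm storage c (overlay ws M) M' →
    Exec vm storage c₀ M M'

/-- On every memory that agrees with the read-set `rs`, transaction `j` terminates and writes
`ws`. -/
def Finished [DecidableEq L] (vm : C → Op L V C) (storage : L → V) (block : List C)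
    (H : History L V) (j : ℕ) (rs : Set (L × Option Version)) (ws : L → Option V) : Prop :=
  Recorded H rs ∧ ∀ c₀, block[j]? = some c₀ → ∀ M, ReadsFrom H rs M →
    Exec vm storage c₀ M (overlay ws M)

/-- All entries of the transaction are estimates, at the locations that it wrote last. -/
def View.Stale (x : View L V) : Prop :=
  ∀ l, (l ∈ x.written → x.col l = some .estimate) ∧ (l ∉ x.written → x.col l = none)

/-- The entries of the transaction are the values `ws`, written by its incarnation `i`. -/
def View.Current (x : View L V) (i : ℕ) (ws : L → Option V) : Prop :=
  x.written = {l | ws l ≠ none} ∧ ∀ l, x.col l = (ws l).map (.value i)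

/-- The thread is responsible for transaction `j`: it executes it, turns its writes into estimates
after a failed validation, or is about to resume it. -/
def PC.holds : PC L V C → ℕ → Prop
  | .loop (some (.execution v)), j | .tryExecute v, j | .vmRun v _ _ _, j
  | .depAcquire v _, j | .depCheck v _, j | .depRetry v _, j | .depAbort v _, j
  | .depInsert v _, j
  | .applyWrites v _ _ _, j | .removeOld v _ _ _ _, j | .storeReads v _ _, j
  | .finStatus v _, j
  | .convLoad v, j | .convert v _, j | .valSetReady v, j => v.1 = j
  | .resume _ _ _ todo, j => j ∈ todo
  | _, _ => False

section Invariant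

variable [DecidableEq L] (vm : C → Op L V C) (storage : L → V) (block : List C) (H : History L V)

/-- The state of a transaction for which nobody is responsible. -/
inductive FreeInv (j : ℕ) (x : View L V) : Prop
  | ready (hs : x.status.2 = .readyToExecute) (hc : x.Stale)
      (hH : H j x.status.1 = fun _ => none)
  | executed (hs : x.status.2 = .executed) (hc : x.Current x.status.1 (H j x.status.1))
      (hf : Finished vm storage block H j x.reads (H j x.status.1))

/-- The state of the transaction of the version `v` while it is executed and has not ended. -/
structure RunInv (v : Version) (x : View L V) : Prop where
  status : x.status = (v.2, .executing)
  stale : x.Stale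
  unwritten : H v.1 v.2 = fun _ => none

/-- The state `x` of transaction `j` when a thread with program counter `p` is responsible for
it. -/
def HolderInv (p : PC L V C) (j : ℕ) (x : View L V) : Prop :=
  match p with
  | .loop (some (.execution v)) | .tryExecute v | .depAcquire v _ | .depCheck v _ | .depRetry v _
  | .depAbort v _ => RunInv H v x
  | .vmRun v c rs ws =>
    RunInv H v x ∧ ∃ c₀, block[v.1]? = some c₀ ∧ Explains vm storage H c₀ c rs ws
  | .depInsert _ _ | .valSetReady _ => x.status.2 = .aborting ∧ x.Stale
  | .applyWrites v rs ws todo =>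
    x.status = (v.2, .executing) ∧ H v.1 v.2 = ws ∧ Finished vm storage block H v.1 rs ws ∧
      ∀ l, (l ∈ todo → ws l ≠ none) ∧
        (ws l ≠ none → l ∉ todo → x.col l = (ws l).map (.value v.2)) ∧
        ((ws l = none ∨ l ∈ todo) →
          (l ∈ x.written → x.col l = some .estimate) ∧ (l ∉ x.written → x.col l = none))
  | .removeOld v rs ws prev todo =>
    x.status = (v.2, .executing) ∧ H v.1 v.2 = ws ∧ Finished vm storage block H v.1 rs ws ∧
      x.written = prev ∧
      ∀ l, (ws l ≠ none → l ∉ todo ∧ x.col l = (ws l).map (.value v.2)) ∧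
        (ws l = none → (l ∈ todo → x.col l = some .estimate) ∧ (l ∉ todo → x.col l = none))
  | .storeReads v rs _ =>
    x.status = (v.2, .executing) ∧ Finished vm storage block H v.1 rs (H v.1 v.2) ∧
      x.Current v.2 (H v.1 v.2)
  | .finStatus v _ =>
    x.status = (v.2, .executing) ∧ Finished vm storage block H v.1 x.reads (H v.1 v.2) ∧
      x.Current v.2 (H v.1 v.2)
  | .resume _ _ deps _ => x.status.2 = .aborting ∧ x.Stale ∧ j ∈ deps
  | .convLoad v => x.status.2 = .aborting ∧ ∃ i, x.Current i (H v.1 i)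
  | .convert _ todo =>
    x.status.2 = .aborting ∧ ∀ l, (l ∈ todo → l ∈ x.written) ∧
      (l ∈ x.written → l ∉ todo → x.col l = some .estimate) ∧ (l ∉ x.written → x.col l = none)
  | _ => False

/-- The state `x` of transaction `j`, depending on who is responsible for it: nobody, a thread, or
the set of dependencies of another transaction. -/
def TxInv (s : Shared L V T) (pc : T → PC L V C) (j : ℕ) (x : View L V) :
    Option (T ⊕ ℕ) → Prop
  | none => FreeInv vm storage block H j x
  | some (.inl t) => (pc t).holds j ∧ HolderInv vm storage block H (pc t) j x
  | some (.inr b) => j ∈ s.txnDependency b ∧ x.status.2 = .aborting ∧ x.Stale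

/-- The ghost variable `owner` says who is responsible for each transaction. -/
structure OwnInv (owner : ℕ → Option (T ⊕ ℕ)) (s : Shared L V T) (pc : T → PC L V C) : Prop where
  thread : ∀ t j, (pc t).holds j → owner j = some (.inl t)
  dep : ∀ b j, j ∈ s.txnDependency b → owner j = some (.inr b)
  tx : ∀ j, TxInv vm storage block H s pc j (s.view j) (owner j)
  hist : ∀ j l i y, s.data (l, j) = some (.value i y) → H j i l = some y
  future : ∀ j i, (s.txnStatus j).1 < i → H j i = fun _ => none

end Invariant

/-- Some history and some assignment of responsibilities fit the state. -/
def Owned [DecidableEq L] (vm : C → Op L V C) (storage : L → V) (block : List C)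
    (s : Shared L V T) (pc : T → PC L V C) : Prop :=
  ∃ H owner, OwnInv vm storage block H owner s pc

variable {vm : C → Op L V C} {storage : L → V} {block : List C}
  {t : T} {s s' : Shared L V T} {p p' : PC L V C} {pc : T → PC L V C} {H H' : History L V}
  {owner owner' : ℕ → Option (T ⊕ ℕ)}

/-- The history `H'` extends `H`. -/
def HistLe (H H' : History L V) : Prop := ∀ j i l x, H j i l = some x → H' j i l = some x

theorem Recorded.mono {rs : Set (L × Option Version)} (h : Recorded H rs) (hle : HistLe H H') :
    Recorded H' rs := fun l v hv => (h l v hv).imp fun _ hx => hle _ _ _ _ hx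

/-- Growth of the history does not change what recorded versions have written. -/
theorem ReadsFrom.anti {rs : Set (L × Option Version)} {M : L → Option V} (hr : Recorded H rs)
    (hle : HistLe H H') (h : ReadsFrom H' rs M) : ReadsFrom H rs M := by
  intro l u hu
  rw [h l u hu]
  rcases u with _ | v
  · rfl
  · obtain ⟨x, hx⟩ := hr l v hu
    change H' v.1 v.2 l = H v.1 v.2 l
    rw [hx, hle _ _ _ _ hx]

variable [DecidableEq L]

theorem Explains.mono {c₀ c : C} {rs : Set (L × Option Version)} {ws : L → Option V}
    (h : Explains vm storage H c₀ c rs ws) (hle : HistLe H H') :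
    Explains vm storage H' c₀ c rs ws :=
  ⟨h.1.mono hle, fun M M' hM hE => h.2 M M' (hM.anti h.1 hle) hE⟩

theorem Finished.mono {j : ℕ} {rs : Set (L × Option Version)} {ws : L → Option V}
    (h : Finished vm storage block H j rs ws) (hle : HistLe H H') :
    Finished vm storage block H' j rs ws :=
  ⟨h.1.mono hle, fun c hc M hM => h.2 c hc M (hM.anti h.1 hle)⟩

theorem FreeInv.mono {j : ℕ} {x : View L V} (h : FreeInv vm storage block H j x)
    (hle : HistLe H H') (hj : H' j = H j) : FreeInv vm storage block H' j x := by
  rcases h with ⟨hs, hc, hH⟩ | ⟨hs, hc, hf⟩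
  · exact .ready hs hc (by rwa [hj])
  · exact .executed hs (by rwa [hj]) (by rw [hj]; exact hf.mono hle)

theorem HolderInv.mono {j : ℕ} {x : View L V} (h : HolderInv vm storage block H p j x)
    (hp : p.holds j) (hle : HistLe H H') (hj : H' j = H j) :
    HolderInv vm storage block H' p j x := by
  have hrun : ∀ v : Version, v.1 = j → RunInv H v x → RunInv H' v x := fun v hv hr =>
    ⟨hr.1, hr.2, by rw [hv, hj, ← hv]; exact hr.3⟩
  cases p with
  | loop task =>
    rcases task with _ | v | v
    · exact h
    · exact hrun v hp h
    · exact h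
  | tryExecute v | depAcquire v | depCheck v | depRetry v | depAbort v => exact hrun v hp h
  | vmRun v c rs ws => exact ⟨hrun v hp h.1, h.2.imp fun _ he => ⟨he.1, he.2.mono hle⟩⟩
  | applyWrites v rs ws todo =>
    cases hp; exact ⟨h.1, by rw [hj]; exact h.2.1, h.2.2.1.mono hle, h.2.2.2⟩
  | removeOld v rs ws prev todo =>
    cases hp; exact ⟨h.1, by rw [hj]; exact h.2.1, h.2.2.1.mono hle, h.2.2.2⟩
  | storeReads v =>
    cases hp; exact ⟨h.1, by rw [hj]; exact h.2.1.mono hle, by rw [hj]; exact h.2.2⟩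
  | finStatus v =>
    cases hp; exact ⟨h.1, by rw [hj]; exact h.2.1.mono hle, by rw [hj]; exact h.2.2⟩
  | convLoad v => cases hp; exact ⟨h.1, by rw [hj]; exact h.2⟩
  | _ => exact h

theorem HolderInv.status {j : ℕ} {x : View L V} (h : HolderInv vm storage block H p j x) :
    x.status.2 = .executing ∨ x.status.2 = .aborting := by
  cases p with
  | loop task =>
    rcases task with _ | v | v
    · exact h.elim
    · exact .inl (by rw [h.1])
    · exact h.elim
  | tryExecute v | depAcquire v | depCheck v | depRetry v | depAbort v => exact .inl (by rw [h.1])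
  | vmRun => exact .inl (by rw [h.1.1])
  | applyWrites | removeOld | storeReads | finStatus => exact .inl (by rw [h.1])
  | depInsert | valSetReady | resume | convLoad | convert => exact .inr h.1
  | _ => exact h.elim

/-- Nobody is responsible for a transaction that is ready or executed. -/
theorem OwnInv.owner_eq_none (hi : OwnInv vm storage block H owner s pc) {j : ℕ}
    (h : (s.txnStatus j).2 = .readyToExecute ∨ (s.txnStatus j).2 = .executed) :
    owner j = none := by
  have hx := hi.tx j
  have hs : (s.view j).status = s.txnStatus j := rfl
  rcases ho : owner j with _ | t | b
  · rfl
  · rw [ho] at hx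
    have := hx.2.status
    rw [hs] at this
    rcases h with h | h <;> simp [h] at this
  · rw [ho] at hx
    have := hx.2.1
    rw [hs] at this
    rcases h with h | h <;> simp [h] at this

theorem OwnInv.holder (hi : OwnInv vm storage block H owner s pc) {j : ℕ} (h : (pc t).holds j) :
    HolderInv vm storage block H (pc t) j (s.view j) := by
  have hx := hi.tx j
  rw [hi.thread t j h] at hx
  exact hx.2

variable [DecidableEq T]

/-- A step that only affects transaction `k`. -/
theorem OwnInv.update (hi : OwnInv vm storage block H owner s pc) (k : ℕ)
    (hview : ∀ j, j ≠ k → s'.view j = s.view j)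
    (hdep : ∀ b j, j ≠ k → (j ∈ s'.txnDependency b ↔ j ∈ s.txnDependency b))
    (hown : ∀ j, j ≠ k → owner' j = owner j)
    (hle : HistLe H H') (hH : ∀ j, j ≠ k → H' j = H j)
    (hp : ∀ j, j ≠ k → (p'.holds j ↔ (pc t).holds j))
    (hp' : ∀ j x, j ≠ k → (pc t).holds j → HolderInv vm storage block H (pc t) j x →
      HolderInv vm storage block H p' j x)
    (hthread : p'.holds k → owner' k = some (.inl t))
    (hother : ∀ u, u ≠ t → (pc u).holds k → owner' k = some (.inl u))
    (hdepk : ∀ b, k ∈ s'.txnDependency b → owner' k = some (.inr b))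
    (htx : TxInv vm storage block H' s' (Function.update pc t p') k (s'.view k) (owner' k))
    (hhist : ∀ l i y, s'.data (l, k) = some (.value i y) → H' k i l = some y)
    (hfut : ∀ i, (s'.txnStatus k).1 < i → H' k i = fun _ => none) :
    OwnInv vm storage block H' owner' s' (Function.update pc t p') where
  thread u j h := by
    by_cases hj : j = k
    · subst hj
      by_cases hu : u = t
      · subst hu; rw [Function.update_self] at h; exact hthread h
      · rw [Function.update_of_ne hu] at h; exact hother u hu h
    · rw [hown j hj]
      by_cases hu : u = t
      · subst hu; rw [Function.update_self, hp j hj] at h; exact hi.thread u j h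
      · rw [Function.update_of_ne hu] at h; exact hi.thread u j h
  dep b j h := by
    by_cases hj : j = k
    · subst hj; exact hdepk b h
    · rw [hown j hj]; exact hi.dep b j ((hdep b j hj).1 h)
  tx j := by
    by_cases hj : j = k
    · subst hj; exact htx
    · have hx := hi.tx j
      rw [hown j hj, hview j hj]
      rcases ho : owner j with _ | u | b
      · rw [ho] at hx; exact FreeInv.mono hx hle (hH j hj)
      · rw [ho] at hx
        by_cases hu : u = t
        · subst hu
          refine ⟨by rw [Function.update_self, hp j hj]; exact hx.1, ?_⟩
          rw [Function.update_self]
          exact (hp' j _ hj hx.1 hx.2).mono ((hp j hj).2 hx.1) hle (hH j hj)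
        · refine ⟨by rw [Function.update_of_ne hu]; exact hx.1, ?_⟩
          rw [Function.update_of_ne hu]
          exact hx.2.mono hx.1 hle (hH j hj)
      · rw [ho] at hx; exact ⟨(hdep b j hj).2 hx.1, hx.2⟩
  hist j l i y h := by
    by_cases hj : j = k
    · subst hj; exact hhist l i y h
    · have : s.data (l, j) = s'.data (l, j) := (congrFun (congrArg View.col (hview j hj)) l).symm
      rw [hH j hj]; exact hi.hist j l i y (this.trans h)
  future j i h := by
    by_cases hj : j = k
    · subst hj; exact hfut i h
    · have : s.txnStatus j = s'.txnStatus j := (congrArg View.status (hview j hj)).symm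
      rw [hH j hj]; exact hi.future j i (by rw [this]; exact h)

/-- A step of a thread that is and stays responsible exactly for transaction `k`. -/
theorem OwnInv.update_holder (hi : OwnInv vm storage block H owner s pc) (k : ℕ)
    (hview : ∀ j, j ≠ k → s'.view j = s.view j)
    (hdep : s'.txnDependency = s.txnDependency)
    (hle : HistLe H H') (hH : ∀ j, j ≠ k → H' j = H j)
    (hp : ∀ j, (pc t).holds j ↔ k = j) (hp' : ∀ j, p'.holds j ↔ k = j)
    (htx : HolderInv vm storage block H' p' k (s'.view k))
    (hhist : ∀ l i y, s'.data (l, k) = some (.value i y) → H' k i l = some y)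
    (hfut : ∀ i, (s'.txnStatus k).1 < i → H' k i = fun _ => none) :
    OwnInv vm storage block H' owner s' (Function.update pc t p') := by
  have ho : owner k = some (.inl t) := hi.thread t k ((hp k).2 rfl)
  refine hi.update k hview (fun b j _ => by rw [hdep]) (fun _ _ => rfl) hle hH
    (fun j _ => by rw [hp, hp']) (fun j x hj h _ => absurd ((hp j).1 h).symm hj) (fun _ => ho)
    (fun u _ h => hi.thread u k h) (fun b h => hi.dep b k (by rwa [hdep] at h)) ?_ hhist hfut
  rw [ho]
  simp only [TxInv, Function.update_self]
  exact ⟨(hp' k).2 rfl, htx⟩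

/-- A step that changes neither the columns nor the responsibilities. -/
theorem OwnInv.update_neutral (hi : OwnInv vm storage block H owner s pc)
    (hview : ∀ j, s'.view j = s.view j)
    (hdep : s'.txnDependency = s.txnDependency)
    (hp : ∀ j, p'.holds j ↔ (pc t).holds j)
    (hp' : ∀ j x, (pc t).holds j → HolderInv vm storage block H (pc t) j x →
      HolderInv vm storage block H p' j x) :
    OwnInv vm storage block H owner s' (Function.update pc t p') where
  thread u j h := by
    by_cases hu : u = t
    · subst hu; rw [Function.update_self, hp j] at h; exact hi.thread u j h
    · rw [Function.update_of_ne hu] at h; exact hi.thread u j h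
  dep b j h := hi.dep b j (by rwa [hdep] at h)
  tx j := by
    have hx := hi.tx j
    rw [hview j]
    rcases ho : owner j with _ | u | b
    · rw [ho] at hx; exact hx
    · rw [ho] at hx
      by_cases hu : u = t
      · subst hu
        simp only [TxInv, Function.update_self]
        exact ⟨(hp j).2 hx.1, hp' j _ hx.1 hx.2⟩
      · simp only [TxInv, Function.update_of_ne hu]; exact hx
    · rw [ho] at hx; simp only [TxInv, hdep]; exact hx
  hist j l i y h := by
    have : s.data (l, j) = s'.data (l, j) := (congrFun (congrArg View.col (hview j)) l).symm
    exact hi.hist j l i y (this.trans h)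
  future j i h := by
    have : s.txnStatus j = s'.txnStatus j := (congrArg View.status (hview j)).symm
    exact hi.future j i (by rw [this]; exact h)

end BlockSTM

namespace BlockSTM

/-! ### Reads, executions and transfers of responsibility -/

variable {L V C T : Type*} {vm : C → Op L V C} {storage : L → V} {block : List C}
  {t : T} {s s' : Shared L V T} {p p' : PC L V C} {pc : T → PC L V C} {H : History L V}
  {owner : ℕ → Option (T ⊕ ℕ)}

theorem mvRead_eq_ok {data : L × ℕ → Option (Entry V)} {l : L} {j : ℕ} {u : Version} {x : V}
    (h : mvRead data l j = .ok u x) : u.1 < j ∧ data (l, u.1) = some (.value u.2 x) := by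
  induction j with
  | zero => simp [mvRead] at h
  | succ j ih =>
    rw [mvRead] at h
    split at h
    · exact ⟨(ih h).1.trans (Nat.lt_succ_self _), (ih h).2⟩
    · simp at h
    · rename_i hd
      cases h
      exact ⟨Nat.lt_succ_self _, hd⟩

theorem mvRead_eq_readError {data : L × ℕ → Option (Entry V)} {l : L} {j b : ℕ}
    (h : mvRead data l j = .readError b) : b < j := by
  induction j with
  | zero => simp [mvRead] at h
  | succ j ih =>
    rw [mvRead] at h
    split at h
    · exact (ih h).trans (Nat.lt_succ_self _)
    · cases h; exact Nat.lt_succ_self _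
    · simp at h

section Explains

variable [DecidableEq L] {c₀ c c' : C} {rs : Set (L × Option Version)} {ws : L → Option V} {l : L}
  {x : V} {k : V → C}

theorem Explains.init (c : C) : Explains vm storage H c c ∅ (fun _ => none) :=
  ⟨fun _ _ h => h.elim, fun _ _ _ h => h⟩

theorem Explains.write (he : Explains vm storage H c₀ c rs ws) (h : vm c = .write l x c') :
    Explains vm storage H c₀ c' rs (Function.update ws l (some x)) := by
  refine ⟨he.1, fun M M' hM hE => he.2 M M' hM (.write c c' l x _ _ h ?_)⟩
  convert hE using 1
  funext l'
  by_cases hl : l' = l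
  · subst hl; simp [overlay]
  · simp [overlay, hl]

theorem Explains.read_own (he : Explains vm storage H c₀ c rs ws) (h : vm c = .read l k)
    (hw : ws l = some x) : Explains vm storage H c₀ (k x) rs ws := by
  refine ⟨he.1, fun M M' hM hE => he.2 M M' hM (.read c l k _ _ h ?_)⟩
  simpa [overlay, hw] using hE

theorem Explains.read_storage (he : Explains vm storage H c₀ c rs ws) (h : vm c = .read l k)
    (hw : ws l = none) : Explains vm storage H c₀ (k (storage l)) (rs ∪ {(l, none)}) ws := by
  refine ⟨fun l' v hv => he.1 l' v (by simpa using hv), fun M M' hM hE => ?_⟩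
  refine he.2 M M' (fun l' u hu => hM l' u (.inl hu)) (.read c l k _ _ h ?_)
  have hl : M l = none := hM l none (.inr rfl)
  simpa [overlay, hw, hl] using hE

theorem Explains.read_ok {u : Version} (he : Explains vm storage H c₀ c rs ws)
    (h : vm c = .read l k) (hw : ws l = none) (hx : H u.1 u.2 l = some x) :
    Explains vm storage H c₀ (k x) (rs ∪ {(l, some u)}) ws := by
  refine ⟨fun l' v hv => ?_, fun M M' hM hE => ?_⟩
  · rcases hv with hv | hv
    · exact he.1 l' v hv
    · cases hv; exact ⟨x, hx⟩
  · refine he.2 M M' (fun l' u hu => hM l' u (.inl hu)) (.read c l k _ _ h ?_)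
    have hl : M l = some x := (hM l (some u) (.inr rfl)).trans hx
    simpa [overlay, hw, hl] using hE

theorem Explains.finished {j : ℕ} (he : Explains vm storage H c₀ c rs ws) (h : vm c = .ret)
    (hc : block[j]? = some c₀) : Finished vm storage block H j rs ws := by
  refine ⟨he.1, fun c₁ hc₁ M hM => ?_⟩
  cases hc.symm.trans hc₁
  exact he.2 M _ hM (.ret c _ h)

end Explains

theorem View.Stale.no_value {j : ℕ} (h : (s.view j).Stale) {l : L} {i : ℕ} {y : V} :
    s.data (l, j) ≠ some (.value i y) := by
  intro hy
  have h1 : (s.view j).col l = some (.value i y) := hy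
  by_cases hl : l ∈ (s.view j).written
  · rw [(h l).1 hl] at h1; cases h1
  · rw [(h l).2 hl] at h1; cases h1

theorem FreeInv.incarnate [DecidableEq L] {j i : ℕ} {x : View L V}
    (h : FreeInv vm storage block H j x) (hs : x.status = (i, .readyToExecute)) :
    RunInv H (j, i) { x with status := (i, .executing) } := by
  rcases h with ⟨-, hc, hH⟩ | ⟨hs', -, -⟩
  · exact ⟨rfl, hc, by rwa [hs] at hH⟩
  · rw [hs] at hs'; cases hs'

theorem HistLe.refl (H : History L V) : HistLe H H := fun _ _ _ _ h => h

variable [DecidableEq L] [DecidableEq T]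

/-- A step in which the responsibility for `k` passes to `o` and the entries stay the same. -/
theorem OwnInv.transfer (hi : OwnInv vm storage block H owner s pc) (k : ℕ) (o : Option (T ⊕ ℕ))
    (hview : ∀ j, j ≠ k → s'.view j = s.view j) (hdata : s'.data = s.data)
    (hst : (s.txnStatus k).1 ≤ (s'.txnStatus k).1)
    (hdep : ∀ b j, j ≠ k → (j ∈ s'.txnDependency b ↔ j ∈ s.txnDependency b))
    (hp : ∀ j, j ≠ k → (p'.holds j ↔ (pc t).holds j))
    (hp' : ∀ j x, j ≠ k → (pc t).holds j → HolderInv vm storage block H (pc t) j x →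
      HolderInv vm storage block H p' j x)
    (hown : owner k = none ∨ owner k = some (.inl t))
    (hthread : p'.holds k → o = some (.inl t))
    (hdepk : ∀ b, k ∈ s'.txnDependency b → k ∈ s.txnDependency b ∨ o = some (.inr b))
    (htx : TxInv vm storage block H s' (Function.update pc t p') k (s'.view k) o) :
    Owned vm storage block s' (Function.update pc t p') := by
  refine ⟨H, Function.update owner k o, hi.update k hview hdep
    (fun j hj => Function.update_of_ne hj _ _) (HistLe.refl H) (fun _ _ => rfl) hp hp' ?_ ?_ ?_ ?_
    (fun l i y h => hi.hist k l i y (by rwa [hdata] at h))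
    (fun i h => hi.future k i (hst.trans_lt h))⟩
  · simpa using hthread
  · intro u hu h
    rcases hown with h1 | h1 <;> rw [hi.thread u k h] at h1
    · cases h1
    · cases h1; exact absurd rfl hu
  · intro b hb
    rcases hdepk b hb with h | h
    · rcases hown with h1 | h1 <;> rw [hi.dep b k h] at h1 <;> cases h1
    · simpa using h
  · simpa using htx

/-- The finishing thread becomes responsible for the dependencies that it swaps out. -/
theorem OwnInv.swap (hi : OwnInv vm storage block H owner s pc) (k : ℕ)
    (hview : ∀ j, s'.view j = s.view j)
    (hdep : s'.txnDependency = Function.update s.txnDependency k ∅)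
    (hp : ∀ j, ¬ (pc t).holds j) (hp' : ∀ j, p'.holds j ↔ j ∈ s.txnDependency k)
    (htx : ∀ j x, j ∈ s.txnDependency k → x.status.2 = .aborting → x.Stale →
      HolderInv vm storage block H p' j x) :
    Owned vm storage block s' (Function.update pc t p') := by
  classical
  have hmem : ∀ b j, j ∈ s'.txnDependency b ↔ b ≠ k ∧ j ∈ s.txnDependency b := by
    intro b j
    rw [hdep]
    by_cases hb : b = k
    · subst hb; simp
    · simp [hb]
  refine ⟨H, fun j => if j ∈ s.txnDependency k then some (.inl t) else owner j, ?_, ?_, ?_, ?_, ?_⟩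
  · intro u j h
    by_cases hu : u = t
    · subst hu; rw [Function.update_self, hp'] at h; exact if_pos h
    · rw [Function.update_of_ne hu] at h
      have ho := hi.thread u j h
      rw [if_neg]
      · exact ho
      · intro hj; rw [hi.dep k j hj] at ho; cases ho
  · intro b j hj
    rw [hmem] at hj
    have ho := hi.dep b j hj.2
    rw [if_neg]
    · exact ho
    · intro hj'; rw [hi.dep k j hj'] at ho; cases ho; exact hj.1 rfl
  · intro j
    have hx := hi.tx j
    rw [hview j]
    split
    · rename_i hj
      rw [hi.dep k j hj] at hx
      simp only [TxInv, Function.update_self]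
      exact ⟨(hp' j).2 hj, htx j _ hj hx.2.1 hx.2.2⟩
    · rename_i hj
      rcases ho : owner j with _ | u | b
      · rw [ho] at hx; exact hx
      · rw [ho] at hx
        have hu : u ≠ t := fun h => hp j (h ▸ hx.1)
        simp only [TxInv, Function.update_of_ne hu]; exact hx
      · rw [ho] at hx
        refine ⟨(hmem b j).2 ⟨?_, hx.1⟩, hx.2⟩
        rintro rfl; exact hj hx.1
  · intro j l i y h
    have : s.data (l, j) = s'.data (l, j) := (congrFun (congrArg View.col (hview j)) l).symm
    exact hi.hist j l i y (this.trans h)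
  · intro j i h
    have : s.txnStatus j = s'.txnStatus j := (congrArg View.status (hview j)).symm
    exact hi.future j i (by rw [this]; exact h)

end BlockSTM

namespace BlockSTM

/-! ### Every step preserves the columns and the responsibilities -/

variable {L V C T : Type*} [DecidableEq L] [DecidableEq T] {vm : C → Op L V C} {storage : L → V}
  {block : List C}
  {t : T} {s s' : Shared L V T} {p p' : PC L V C} {pc : T → PC L V C} {H H' : History L V}
  {owner : ℕ → Option (T ⊕ ℕ)}

/-- The end of an execution adds its write-set to the history. -/
theorem OwnInv.end_execution (hi : OwnInv vm storage block H owner s pc) {v : Version} {c : C}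
    {rs : Set (L × Option Version)} {ws : L → Option V} (hpc : pc t = .vmRun v c rs ws)
    (h : vm c = .ret) :
    Owned vm storage block s
      (Function.update pc t (.applyWrites v rs ws {l | ws l ≠ none})) := by
  have hx := hi.holder (t := t) (j := v.1) (by rw [hpc]; rfl)
  rw [hpc] at hx
  obtain ⟨⟨hst, hstale, hH⟩, c₀, hc₀, he⟩ := hx
  let H' : History L V := Function.update H v.1 (Function.update (H v.1) v.2 ws)
  have hle : HistLe H H' := by
    intro j i l x hx
    by_cases hj : j = v.1
    · subst hj
      by_cases hi' : i = v.2
      · subst hi'; rw [hH] at hx; cases hx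
      · simpa [H', hi'] using hx
    · simpa [H', hj] using hx
  have hst' : s.txnStatus v.1 = (v.2, .executing) := hst
  refine ⟨H', owner, hi.update_holder (H' := H') v.1 (fun _ _ => rfl) rfl hle
    (fun j hj => Function.update_of_ne hj _ _) (fun j => by rw [hpc]; exact Iff.rfl)
    (fun j => Iff.rfl) ?_ ?_ ?_⟩
  · refine ⟨hst, by simp [H'], (he.finished h hc₀).mono hle, fun l => ?_⟩
    exact ⟨fun hl => hl, fun h1 h2 => absurd h1 h2, fun _ => hstale l⟩
  · intro l i y hy
    exact absurd hy hstale.no_value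
  · intro i hlt
    rw [hst'] at hlt
    have : i ≠ v.2 := ne_of_gt hlt
    simp only [H', Function.update_self, Function.update_of_ne this]
    exact hi.future v.1 i (by rw [hst']; exact hlt)

/-- Every step takes a state with consistent responsibilities to such a state. A thread that joins
drops its task, so this needs that `doneMarker` is only set when there are no tasks. -/
theorem OwnInv.step (hi : OwnInv vm storage block H owner s pc)
    (hd : s.doneMarker = true → (pc t).quiet block.length)
    (h : ThreadStep vm storage block t s (pc t) s' p') :
    Owned vm storage block s' (Function.update pc t p') := by
  have hn := hi.update_neutral (t := t) (s' := s') (p' := p')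
  have hk := fun k => hi.update_holder (t := t) (s' := s') (p' := p') k (H' := H)
  have htr := fun k o => hi.transfer (t := t) (s' := s') (p' := p') k o
  have hown := hi.thread t
  have hold : ∀ j, (pc t).holds j → HolderInv vm storage block H (pc t) j (s.view j) :=
    fun _ => hi.holder
  generalize hpc : pc t = p at h hd
  rw [hpc] at hn hold hown
  simp only [hpc] at hk htr
  cases h with
  | loop_done task h =>
    rcases task with _ | v | v
    · exact ⟨H, owner, hn (fun _ => rfl) rfl (fun _ => Iff.rfl) (fun _ _ _ hx => hx)⟩
    · exact absurd trivial (hd h)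
    · exact ⟨H, owner, hn (fun _ => rfl) rfl (fun _ => Iff.rfl) (fun _ _ _ hx => hx)⟩
  | tryExecute v c h =>
    refine ⟨H, owner, hn (fun _ => rfl) rfl (fun _ => Iff.rfl) (fun _ _ _ hx => ⟨hx, ?_⟩)⟩
    exact ⟨c, h, .init c⟩
  | vm_write v c c' rs ws l x h =>
    exact ⟨H, owner, hn (fun _ => rfl) rfl (fun _ => Iff.rfl)
      (fun _ _ _ hx => ⟨hx.1, hx.2.imp fun _ he => ⟨he.1, he.2.write h⟩⟩)⟩
  | vm_read_own v c rs ws l k x h hw =>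
    exact ⟨H, owner, hn (fun _ => rfl) rfl (fun _ => Iff.rfl)
      (fun _ _ _ hx => ⟨hx.1, hx.2.imp fun _ he => ⟨he.1, he.2.read_own h hw⟩⟩)⟩
  | vm_read_storage v c rs ws l k h hw hr =>
    exact ⟨H, owner, hn (fun _ => rfl) rfl (fun _ => Iff.rfl)
      (fun _ _ _ hx => ⟨hx.1, hx.2.imp fun _ he => ⟨he.1, he.2.read_storage h hw⟩⟩)⟩
  | vm_read_ok v c rs ws l k u x h hw hr =>
    exact ⟨H, owner, hn (fun _ => rfl) rfl (fun _ => Iff.rfl)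
      (fun _ _ _ hx => ⟨hx.1, hx.2.imp fun _ he =>
        ⟨he.1, he.2.read_ok h hw (hi.hist _ _ _ _ (mvRead_eq_ok hr).2)⟩⟩)⟩
  | vm_read_error v c rs ws l k b h hw hr =>
    exact ⟨H, owner, hn (fun _ => rfl) rfl (fun _ => Iff.rfl) (fun _ _ _ hx => hx.1)⟩
  | vm_ret v c rs ws h => exact hi.end_execution hpc h
  | dep_abort v b =>
    have hx := hold v.1 rfl
    refine ⟨H, owner, hk v.1 (fun j hj => by simp [Shared.view, hj]) rfl (.refl H)
      (fun _ _ => trivial) (fun _ => Iff.rfl) (fun _ => Iff.rfl) ⟨?_, hx.stale⟩ (hi.hist v.1) ?_⟩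
    · simp [Shared.view]
    · simpa using hi.future v.1
  | dep_insert v b =>
    have hx := hold v.1 rfl
    refine htr v.1 (some (.inr b)) (fun _ _ => rfl) rfl le_rfl (fun b' j hj => ?_)
      (fun j hj => iff_of_false id hj.symm) (fun j _ hj h _ => absurd h.symm hj)
      (.inr (hown v.1 rfl)) False.elim (fun b' hb => ?_) ⟨?_, hx⟩
    · by_cases hb : b' = b
      · subst hb; simp [hj]
      · simp [hb]
    · by_cases h : b' = b
      · subst h; exact .inr rfl
      · left; simpa [h] using hb
    · simp
  | apply_write v rs ws todo l x hl hx =>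
    obtain ⟨hs, hH, hf, hc⟩ := hold v.1 rfl
    have hcol : ∀ l', Function.update s.data (l, v.1) (some (Entry.value v.2 x)) (l', v.1) =
        if l' = l then some (.value v.2 x) else s.data (l', v.1) := by
      intro l'; simp [Function.update_apply]
    refine ⟨H, owner, hk v.1 (fun j hj => by simp [Shared.view, hj]) rfl (.refl H)
      (fun _ _ => trivial) (fun _ => Iff.rfl) (fun _ => Iff.rfl) ⟨hs, hH, hf, fun l' => ?_⟩ ?_
      (hi.future v.1)⟩
    · have h1 := hc l'
      by_cases hl' : l' = l
      · subst hl'; simp [Shared.view, hx]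
      · simpa [Shared.view, hcol, hl'] using h1
    · intro l' i y hy
      have hy' := (hcol l').symm.trans hy
      by_cases hl' : l' = l
      · subst hl'; rw [if_pos rfl] at hy'; cases hy'; rw [hH, hx]
      · rw [if_neg hl'] at hy'; exact hi.hist _ _ _ _ hy'
  | apply_end v rs ws =>
    obtain ⟨hs, hH, hf, hc⟩ := hold v.1 rfl
    refine ⟨H, owner, hk v.1 (fun j hj => rfl) rfl (.refl H)
      (fun _ _ => trivial) (fun _ => Iff.rfl) (fun _ => Iff.rfl) ⟨hs, hH, hf, rfl, fun l => ?_⟩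
      (hi.hist v.1) (hi.future v.1)⟩
    obtain ⟨-, h1, h2⟩ := hc l
    refine ⟨fun hw => ⟨fun h => h.2 hw, h1 hw id⟩, fun hw => ⟨fun h => (h2 (.inl hw)).1 h.1,
      fun h => (h2 (.inl hw)).2 fun hl => h ⟨hl, fun h => h hw⟩⟩⟩
  | remove_old v rs ws prev todo l hl =>
    obtain ⟨hs, hH, hf, hW, hc⟩ := hold v.1 rfl
    have hcol : ∀ l', Function.update s.data (l, v.1) none (l', v.1) =
        if l' = l then none else s.data (l', v.1) := by
      intro l'; simp [Function.update_apply]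
    refine ⟨H, owner, hk v.1 (fun j hj => by simp [Shared.view, hj]) rfl (.refl H)
      (fun _ _ => trivial) (fun _ => Iff.rfl) (fun _ => Iff.rfl) ⟨hs, hH, hf, hW, fun l' => ?_⟩ ?_
      (hi.future v.1)⟩
    · have h1 := hc l'
      by_cases hl' : l' = l
      · subst hl'
        have : ws l' = none := by by_contra h; exact (h1.1 h).1 hl
        simp [Shared.view, this]
      · simpa [Shared.view, hcol, hl'] using h1
    · intro l' i y hy
      have hy' := (hcol l').symm.trans hy
      by_cases hl' : l' = l
      · subst hl'; rw [if_pos rfl] at hy'; cases hy'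
      · rw [if_neg hl'] at hy'; exact hi.hist _ _ _ _ hy'
  | remove_end v rs ws prev =>
    obtain ⟨hs, hH, hf, hW, hc⟩ := hold v.1 rfl
    refine ⟨H, owner, hk v.1 (fun j hj => by simp [Shared.view, hj]) rfl (.refl H)
      (fun _ _ => trivial) (fun _ => Iff.rfl) (fun _ => Iff.rfl)
      ⟨hs, by rw [hH]; exact hf, by simp [Shared.view, hH], fun l => ?_⟩
      (hi.hist v.1) (hi.future v.1)⟩
    rw [hH]
    by_cases hw : ws l = none
    · rw [hw]; exact ((hc l).2 hw).2 id
    · exact ((hc l).1 hw).2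
  | store_reads v rs wroteNew =>
    obtain ⟨hs, hf, hc⟩ := hold v.1 rfl
    refine ⟨H, owner, hk v.1 (fun j hj => by simp [Shared.view, hj]) rfl (.refl H)
      (fun _ _ => trivial) (fun _ => Iff.rfl) (fun _ => Iff.rfl)
      ⟨hs, by simpa [Shared.view] using hf, hc⟩ (hi.hist v.1) (hi.future v.1)⟩
  | fin_status v wroteNew =>
    obtain ⟨hs, hf, hc⟩ := hold v.1 rfl
    have hs' : s.txnStatus v.1 = (v.2, .executing) := hs
    refine htr v.1 none (fun j hj => by simp [Shared.view, hj]) rfl (by simp) (fun _ _ _ => Iff.rfl)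
      (fun j hj => iff_of_false id hj.symm) (fun j _ hj h _ => absurd h.symm hj)
      (.inr (hown v.1 rfl)) False.elim (fun _ h => .inl h) (.executed ?_ ?_ ?_)
    · simp [Shared.view]
    · simpa [Shared.view, hs', View.Current] using hc
    · simpa [Shared.view, hs'] using hf
  | fin_swap v wroteNew h =>
    exact hi.swap v.1 (fun _ => rfl) rfl (fun j hj => by rw [hpc] at hj; exact hj)
      (fun _ => Iff.rfl) (fun j x hj h1 h2 => ⟨h1, h2, hj⟩)
  | resume_ready v wroteNew deps todo d hd' =>
    have hx := hold d hd'
    refine htr d none (fun j hj => by simp [Shared.view, hj]) rfl (by simp) (fun _ _ _ => Iff.rfl)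
      (fun j hj => ⟨fun h => h.1, fun h => ⟨h, hj⟩⟩) (fun j _ hj h h' => h')
      (.inr (hown d hd')) (fun h => absurd rfl h.2) (fun _ h => .inl h) (.ready ?_ hx.2.1 ?_)
    · simp [Shared.view]
    · simpa [Shared.view] using hi.future d _ (Nat.lt_succ_self _)
  | val_abort v h =>
    have ho := hi.owner_eq_none (j := v.1) (.inr (by rw [h]))
    have hx := hi.tx v.1
    rw [ho] at hx
    refine htr v.1 (some (.inl t)) (fun j hj => by simp [Shared.view, hj]) rfl (by simp [h])
      (fun _ _ _ => Iff.rfl) (fun j hj => iff_of_false hj.symm id) (fun j _ hj h _ => h.elim)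
      (.inl ho) (fun _ => rfl) (fun _ h => .inl h) ?_
    simp only [TxInv, Function.update_self]
    refine ⟨rfl, by simp [Shared.view], v.2, ?_⟩
    rcases hx with ⟨hs, -, -⟩ | ⟨-, hc, -⟩
    · have hs' : (s.txnStatus v.1).2 = .readyToExecute := hs
      rw [h] at hs'; cases hs'
    · have : (s.view v.1).status.1 = v.2 := congrArg Prod.fst h
      rwa [this] at hc
  | conv_load v =>
    obtain ⟨hs, i, hW, hc⟩ := hold v.1 rfl
    refine ⟨H, owner, hk v.1 (fun j hj => rfl) rfl (.refl H)
      (fun _ _ => trivial) (fun _ => Iff.rfl) (fun _ => Iff.rfl)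
      ⟨hs, fun l => ⟨id, fun h1 h2 => absurd h1 h2, fun h1 => ?_⟩⟩
      (hi.hist v.1) (hi.future v.1)⟩
    rw [hW] at h1
    have : H v.1 i l = none := not_not.1 h1
    rw [hc l, this]; rfl
  | convert_one v todo l hl =>
    obtain ⟨hs, hc⟩ := hold v.1 rfl
    have hcol : ∀ l', Function.update s.data (l, v.1) (some Entry.estimate) (l', v.1) =
        if l' = l then some .estimate else s.data (l', v.1) := by
      intro l'; simp [Function.update_apply]
    refine ⟨H, owner, hk v.1 (fun j hj => by simp [Shared.view, hj]) rfl (.refl H)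
      (fun _ _ => trivial) (fun _ => Iff.rfl) (fun _ => Iff.rfl) ⟨hs, fun l' => ?_⟩ ?_
      (hi.future v.1)⟩
    · have h1 := hc l'
      by_cases hl' : l' = l
      · subst hl'
        have : l' ∈ s.lastWritten v.1 := h1.1 hl
        simp [Shared.view, this]
      · simpa [Shared.view, hcol, hl'] using h1
    · intro l' i y hy
      have hy' := (hcol l').symm.trans hy
      by_cases hl' : l' = l
      · subst hl'; rw [if_pos rfl] at hy'; cases hy'
      · rw [if_neg hl'] at hy'; exact hi.hist _ _ _ _ hy'
  | convert_end v =>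
    exact ⟨H, owner, hn (fun _ => rfl) rfl (fun _ => Iff.rfl)
      (fun _ x _ hx => ⟨hx.1, fun l => ⟨fun h => (hx.2 l).2.1 h id, (hx.2 l).2.2⟩⟩)⟩
  | val_set_ready v =>
    obtain ⟨hs, hx⟩ := hold v.1 rfl
    refine htr v.1 none (fun j hj => by simp [Shared.view, hj]) rfl (by simp) (fun _ _ _ => Iff.rfl)
      (fun j hj => iff_of_false id hj.symm) (fun j _ hj h _ => absurd h.symm hj)
      (.inr (hown v.1 rfl)) False.elim (fun _ h => .inl h) (.ready ?_ hx ?_)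
    · simp [Shared.view]
    · simpa [Shared.view] using hi.future v.1 _ (Nat.lt_succ_self _)
  | val_incarnate v i hb h =>
    have ho := hi.owner_eq_none (j := v.1) (.inl (by rw [h]))
    have hx := hi.tx v.1
    rw [ho] at hx
    refine htr v.1 (some (.inl t)) (fun j hj => by simp [Shared.view, hj]) rfl (by simp [h])
      (fun _ _ _ => Iff.rfl) (fun j hj => iff_of_false hj.symm id) (fun j _ hj h _ => h.elim)
      (.inl ho) (fun _ => rfl) (fun _ h => .inl h) ?_
    simp only [TxInv, Function.update_self]
    exact ⟨rfl, by simpa [afterValidation, HolderInv, Shared.view] using hx.incarnate h⟩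
  | exec_incarnate j i hb h =>
    have ho := hi.owner_eq_none (j := j) (.inl (by rw [h]))
    have hx := hi.tx j
    rw [ho] at hx
    refine htr j (some (.inl t)) (fun j hj => by simp [Shared.view, hj]) rfl (by simp [h])
      (fun _ _ _ => Iff.rfl) (fun j hj => iff_of_false hj.symm id) (fun j _ hj h _ => h.elim)
      (.inl ho) (fun _ => rfl) (fun _ h => .inl h) ?_
    simp only [TxInv, Function.update_self]
    exact ⟨rfl, by simpa [afterValidation, HolderInv, Shared.view] using hx.incarnate h⟩
  | resume_none | resume_decrease =>
    exact ⟨H, owner, hn (fun _ => rfl) rfl (fun _ => Iff.rfl) (fun _ _ h _ => h.elim)⟩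
  | _ => exact ⟨H, owner, hn (fun _ => rfl) rfl (fun _ => Iff.rfl) (fun _ _ _ hx => hx)⟩

end BlockSTM

namespace BlockSTM

variable {L V C T : Type*}

/-! ### Every transaction that is not executed will be executed -/

/-- The thread will try to incarnate transaction `j`, or lower `executionIdx` to at most `j`, if
this is necessary. -/
def PC.schedules : PC L V C → ℕ → Prop
  | .execIncarnate k, j => k = j
  | .resume _ _ deps _, j => j ∈ deps
  | .valDecreaseVal v, j | .valCount v, j | .valCheckExec v, j | .valIncarnate v, j => v.1 = j
  | _, _ => False

/-- The thread holds the lock of the dependencies of transaction `b`. -/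
def PC.locks : PC L V C → ℕ → Prop
  | .depCheck _ b, k | .depRetry _ b, k | .depAbort _ b, k | .depInsert _ b, k
  | .depRelease _ b, k => b = k
  | _, _ => False

/-- The thread is adding transaction `j` to the dependencies of transaction `b`. -/
def PC.awaits : PC L V C → ℕ → ℕ → Prop
  | .depAcquire v b, j, k | .depCheck v b, j, k | .depAbort v b, j, k | .depInsert v b, j, k =>
    v.1 = j ∧ b = k
  | _, _, _ => False

/-- The thread has decided to add a transaction to the dependencies of transaction `b`. -/
def PC.blocked : PC L V C → ℕ → Prop
  | .depAbort _ b, k | .depInsert _ b, k => b = k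
  | _, _ => False

/-- The thread is about to resume the dependencies of transaction `b`. -/
def PC.swaps : PC L V C → ℕ → Prop
  | .finSwap v _, b => v.1 = b
  | _, _ => False

/-- A transaction that is ready is about to be fetched, and a transaction in the dependencies of
another one will be resumed: the latter is smaller, and it is not executed or its dependencies are
about to be swapped out. -/
structure ExecInv (n : ℕ) (s : Shared L V T) (pc : T → PC L V C) : Prop where
  ready : ∀ j < n, (s.txnStatus j).2 = .readyToExecute →
    s.executionIdx ≤ j ∨ ∃ t, (pc t).schedules j
  lock : ∀ t b, (pc t).locks b → s.depLock b = some t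
  awaits_lt : ∀ t j b, (pc t).awaits j b → b < j
  dep_lt : ∀ b j, j ∈ s.txnDependency b → b < j
  blocked : ∀ b, ((s.txnDependency b).Nonempty ∨ ∃ t, (pc t).blocked b) →
    (s.txnStatus b).2 ≠ .executed ∨ ∃ t, (pc t).swaps b

theorem exists_update [DecidableEq T] {P : PC L V C → Prop} {pc : T → PC L V C} {t : T}
    {p' : PC L V C} (h : ∃ u, P (pc u)) (ht : ¬ P (pc t)) :
    ∃ u, P (Function.update pc t p' u) := by
  obtain ⟨u, hu⟩ := h
  have : u ≠ t := by rintro rfl; exact ht hu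
  exact ⟨u, by rwa [Function.update_of_ne this]⟩

variable [DecidableEq L] {vm : C → Op L V C} {storage : L → V} {block : List C}
  {t : T} {s s' : Shared L V T} {p p' : PC L V C} {pc : T → PC L V C}

theorem ThreadStep.ready_of_ready (h : ThreadStep vm storage block t s p s' p')
    (hres : ∀ v w deps todo, p = .resume v w deps todo → todo ⊆ deps) {j : ℕ}
    (hr : (s'.txnStatus j).2 = .readyToExecute) :
    (s.txnStatus j).2 = .readyToExecute ∨ p'.schedules j := by
  cases h with
  | resume_ready v w deps todo d hd =>
    by_cases hj : j = d
    · subst hj; exact .inr (hres _ _ _ _ rfl hd)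
    · exact .inl (by simpa [hj] using hr)
  | val_set_ready v =>
    by_cases hj : j = v.1
    · exact .inr hj.symm
    · exact .inl (by simpa [hj] using hr)
  | dep_abort v | fin_status v | val_abort v | val_incarnate v =>
    by_cases hj : j = v.1
    · subst hj; simp at hr
    · exact .inl (by simpa [hj] using hr)
  | exec_incarnate k =>
    by_cases hj : j = k
    · subst hj; simp at hr
    · exact .inl (by simpa [hj] using hr)
  | _ => exact .inl hr

theorem ThreadStep.executionIdx_le_or_schedules (h : ThreadStep vm storage block t s p s' p')
    {j : ℕ} (hj : s.executionIdx ≤ j) : s'.executionIdx ≤ j ∨ p'.schedules j := by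
  cases h with
  | exec_fetch => exact (Nat.lt_or_eq_of_le hj).imp id id
  | resume_decrease => exact .inl ((min_le_left _ _).trans hj)
  | _ => exact .inl hj

theorem ThreadStep.schedules (h : ThreadStep vm storage block t s p s' p') {j : ℕ}
    (hj : j < block.length) (hp : p.schedules j) (hr : (s'.txnStatus j).2 = .readyToExecute) :
    s'.executionIdx ≤ j ∨ p'.schedules j := by
  cases h with
  | exec_no_incarnate k h => cases hp; exact absurd ⟨hj, hr⟩ h
  | val_no_incarnate v h => cases hp; exact absurd ⟨hj, hr⟩ h
  | val_check_exec_small v h => cases hp; exact .inl (not_lt.1 h)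
  | resume_decrease v w deps m hm => exact .inl ((min_le_right _ _).trans (hm.2 hp))
  | exec_incarnate k => cases hp; simp at hr
  | val_incarnate v => cases hp; simp at hr
  | resume_none => exact hp.elim
  | _ => first | exact hp.elim | exact .inr hp

theorem ThreadStep.blocked (h : ThreadStep vm storage block t s p s' p') {b : ℕ}
    (hp : p'.blocked b) : p.blocked b ∨ (s.txnStatus b).2 ≠ .executed := by
  cases h with
  | dep_check_blocked v b h => cases hp; exact .inr h
  | _ => first | exact hp.elim | exact .inl hp

theorem ThreadStep.not_executed (h : ThreadStep vm storage block t s p s' p') {b : ℕ}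
    (hb : (s.txnStatus b).2 ≠ .executed) : (s'.txnStatus b).2 ≠ .executed ∨ p'.swaps b := by
  cases h with
  | fin_status v =>
    by_cases hj : b = v.1
    · exact .inr hj.symm
    · exact .inl (by simpa [hj] using hb)
  | dep_abort v | val_abort v | val_incarnate v | val_set_ready v =>
    by_cases hj : b = v.1
    · subst hj; simp
    · exact .inl (by simpa [hj] using hb)
  | exec_incarnate k | resume_ready _ _ _ _ k =>
    by_cases hj : b = k
    · subst hj; simp
    · exact .inl (by simpa [hj] using hb)
  | _ => exact .inl hb

theorem ThreadStep.awaits (h : ThreadStep vm storage block t s p s' p') {j b : ℕ}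
    (hp : p'.awaits j b) : p.awaits j b ∨ b < j := by
  cases h with
  | vm_read_error v c rs ws l k b h hw hr =>
    obtain ⟨rfl, rfl⟩ := hp; exact .inr (mvRead_eq_readError hr)
  | _ => first | exact hp.elim | exact .inl hp

theorem ThreadStep.dependency (h : ThreadStep vm storage block t s p s' p') {j b : ℕ}
    (hj : j ∈ s'.txnDependency b) : j ∈ s.txnDependency b ∨ p.awaits j b ∧ p.blocked b := by
  cases h with
  | dep_insert v k =>
    by_cases hb : b = k
    · subst hb
      simp only [Function.update_self] at hj
      exact hj.imp id fun h => ⟨⟨h.symm, rfl⟩, rfl⟩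
    · exact .inl (by simpa [hb] using hj)
  | fin_swap v w h =>
    by_cases hb : b = v.1
    · subst hb; simp at hj
    · exact .inl (by simpa [hb] using hj)
  | _ => exact .inl hj

/-- The dependencies of `b` are only swapped out while nobody holds their lock. -/
theorem ThreadStep.swaps (h : ThreadStep vm storage block t s p s' p') {b : ℕ}
    (hp : p.swaps b) : s'.txnDependency b = ∅ ∧ s.depLock b = none ∧ ∀ k, ¬ p'.blocked k := by
  cases h with
  | fin_swap v w h => cases hp; exact ⟨by simp, h, fun _ => id⟩
  | _ => exact hp.elim

variable [DecidableEq T]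

theorem ExecInv.lock_step (hi : ExecInv block.length s pc)
    (h : ThreadStep vm storage block t s (pc t) s' p') (u : T) (b : ℕ)
    (hu : (Function.update pc t p' u).locks b) : s'.depLock b = some u := by
  have hl := hi.lock u b
  have ht := hi.lock t
  generalize hpc : pc t = p at h ht
  by_cases hut : u = t
  · subst hut
    rw [Function.update_self] at hu
    rw [hpc] at hl
    cases h with
    | dep_acquire v k h => cases hu; simp
    | _ => first | exact hu.elim | exact hl hu
  · rw [Function.update_of_ne hut] at hu
    have hl := hl hu
    cases h with
    | dep_acquire v k h =>
      have : b ≠ k := by rintro rfl; rw [h] at hl; cases hl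
      simpa [this] using hl
    | dep_retry v k | dep_release v k =>
      have : b ≠ k := by
        rintro rfl; rw [ht b rfl] at hl; cases hl; exact hut rfl
      simpa [this] using hl
    | _ => exact hl

theorem ExecInv.step (hi : ExecInv block.length s pc)
    (hres : ∀ v w deps todo, pc t = .resume v w deps todo → todo ⊆ deps)
    (h : ThreadStep vm storage block t s (pc t) s' p') :
    ExecInv block.length s' (Function.update pc t p') where
  ready j hj hr := by
    have hp : p'.schedules j → ∃ u, (Function.update pc t p' u).schedules j := fun hp =>
      ⟨t, by simpa using hp⟩
    rcases h.ready_of_ready hres hr with hr' | hr'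
    · rcases hi.ready j hj hr' with he | hu
      · exact (h.executionIdx_le_or_schedules he).imp_right hp
      · by_cases ht : (pc t).schedules j
        · exact (h.schedules hj ht hr).imp_right hp
        · exact .inr (exists_update (P := fun p => p.schedules j) hu ht)
    · exact .inr (hp hr')
  lock u b hu := hi.lock_step h u b hu
  awaits_lt u j b hu := by
    by_cases hut : u = t
    · subst hut
      rw [Function.update_self] at hu
      exact (h.awaits hu).elim (hi.awaits_lt u j b) id
    · rw [Function.update_of_ne hut] at hu; exact hi.awaits_lt u j b hu
  dep_lt b j hj := (h.dependency hj).elim (hi.dep_lt b j) fun hp => hi.awaits_lt t j b hp.1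
  blocked b hb := by
    have key : ((s.txnDependency b).Nonempty ∨ ∃ t, (pc t).blocked b) ∨
        (s.txnStatus b).2 ≠ .executed := by
      rcases hb with ⟨j, hj⟩ | ⟨u, hu⟩
      · exact .inl ((h.dependency hj).imp (fun h => ⟨j, h⟩) fun h => ⟨t, h.2⟩)
      · by_cases hut : u = t
        · subst hut
          rw [Function.update_self] at hu
          exact (h.blocked hu).imp (fun h => .inr ⟨u, h⟩) id
        · rw [Function.update_of_ne hut] at hu; exact .inl (.inr ⟨u, hu⟩)
    rcases key.elim (hi.blocked b) .inl with hne | hsw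
    · exact (h.not_executed hne).imp_right fun hp => ⟨t, by simpa using hp⟩
    · by_cases ht : (pc t).swaps b
      · exfalso
        obtain ⟨h1, h2, h3⟩ := h.swaps ht
        rcases hb with hb | ⟨u, hu⟩
        · rw [h1] at hb; exact Set.not_nonempty_empty hb
        · by_cases hut : u = t
          · subst hut; rw [Function.update_self] at hu; exact h3 b hu
          · rw [Function.update_of_ne hut] at hu
            have hl : (pc u).locks b := by
              revert hu; cases pc u <;> first | exact id | exact False.elim
            rw [hi.lock u b hl] at h2; cases h2
      · exact .inr (exists_update (P := fun p => p.swaps b) hsw ht)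

end BlockSTM

namespace BlockSTM

variable {L V C T : Type*}

/-! ### Every executed transaction has been validated or will be -/

/-- The reads recorded for transaction `j` that would fail a validation now. -/
def Shared.mismatches (s : Shared L V T) (j : ℕ) : Set (L × Option Version) :=
  {a | a ∈ s.lastRead j ∧ ¬ readMatches a.2 (mvRead s.data a.1 j)}

/-- The thread will lower `validationIdx` to at most `j`, if this is necessary, because it writes
new locations or turns writes into estimates. `W` gives the last written locations. -/
def PC.lowers (W : ℕ → Set L) : PC L V C → ℕ → Prop
  | .applyWrites v _ ws _, j => v.1 ≤ j ∧ ({l | ws l ≠ none} \ W v.1).Nonempty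
  | .removeOld v _ ws prev _, j => v.1 ≤ j ∧ ({l | ws l ≠ none} \ prev).Nonempty
  | .storeReads v _ w, j | .finStatus v w, j | .finSwap v w, j | .resume v w _ _, j
  | .resumeCount v w, j | .finCheck v w, j => v.1 ≤ j ∧ w
  | .finDecreaseVal v, j => v.1 ≤ j
  | .convert v _, j | .valSetReady v, j | .valDecreaseVal v, j => v.1 < j
  | _, _ => False

/-- The thread will validate the version `v`, or will see that `validationIdx` is small enough, or
is validating it and has not yet checked the reads in `B`. -/
def PC.checks : PC L V C → Version → Set (L × Option Version) → Prop
  | .finSwap u _, v, _ | .resume u _ _ _, v, _ | .resumeCount u _, v, _ | .finCheck u _, v, _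
  | .loop (some (.validation u)), v, _ | .valLoad u, v, _ | .valTryAbort u, v, _ => u = v
  | .valStatus k, v, _ => k = v.1
  | .valReads u todo, v, B => u = v ∧ B ⊆ todo
  | _, _, _ => False

/-- Transaction `j` is ahead of `validationIdx`, or some thread will lower this index so far. -/
def Covered (s : Shared L V T) (pc : T → PC L V C) (j : ℕ) : Prop :=
  s.validationIdx ≤ j ∨ ∃ t, (pc t).lowers s.lastWritten j

/-- For each executed transaction, all recorded reads are up to date, or it is going to be
validated. -/
def ValInv (n : ℕ) (s : Shared L V T) (pc : T → PC L V C) : Prop :=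
  ∀ j < n, ∀ i, s.txnStatus j = (i, .executed) →
    s.mismatches j = ∅ ∨ Covered s pc j ∨ ∃ t, (pc t).checks (j, i) (s.mismatches j)

theorem PC.checks_mono {p : PC L V C} {v : Version} {A B : Set (L × Option Version)}
    (h : p.checks v B) (hAB : A ⊆ B) : p.checks v A := by
  cases p with
  | valReads => exact ⟨h.1, hAB.trans h.2⟩
  | loop task => rcases task with _ | _ | _ <;> exact h
  | _ => exact h

variable [DecidableEq L] {vm : C → Op L V C} {storage : L → V} {block : List C}
  {t : T} {s s' : Shared L V T} {p p' : PC L V C} {pc : T → PC L V C} {H : History L V}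
  {owner : ℕ → Option (T ⊕ ℕ)}

theorem mvRead_update_of_le (data : L × ℕ → Option (Entry V)) (l l' : L) {j k : ℕ} (hj : j ≤ k)
    (e : Option (Entry V)) : mvRead (Function.update data (l, k) e) l' j = mvRead data l' j := by
  induction j with
  | zero => rfl
  | succ j ih =>
    have : (l', j) ≠ (l, k) := by simp; omega
    rw [mvRead, mvRead, Function.update_of_ne this, ih (by omega)]

/-- Replacing an estimate only changes the reads that return an error. -/
theorem mvRead_update_estimate {data : L × ℕ → Option (Entry V)} {l : L} {k : ℕ}
    (h : data (l, k) = some .estimate) (e : Option (Entry V)) (l' : L) (j : ℕ) :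
    mvRead (Function.update data (l, k) e) l' j = mvRead data l' j ∨
      mvRead data l' j = .readError k := by
  induction j with
  | zero => exact .inl rfl
  | succ j ih =>
    by_cases hl : (l', j) = (l, k)
    · cases hl; right; rw [mvRead, h]
    · rw [mvRead, mvRead, Function.update_of_ne hl]
      rcases data (l', j) with _ | _ | _
      · exact ih
      · exact .inl rfl
      · exact .inl rfl

theorem mismatches_update_estimate {data' : L × ℕ → Option (Entry V)} {l : L} {k : ℕ}
    (h : s.data (l, k) = some .estimate) (e : Option (Entry V))
    (hd : data' = Function.update s.data (l, k) e) (j : ℕ) :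
    ({ s with data := data' } : Shared L V T).mismatches j ⊆ s.mismatches j := by
  rintro ⟨l', u⟩ ⟨hr, hm⟩
  refine ⟨hr, fun hm' => hm ?_⟩
  simp only [hd]
  rcases mvRead_update_estimate h e l' j with h1 | h1
  · rwa [h1]
  · rw [h1] at hm'; exact hm'.elim

theorem mismatches_update_of_le {data' : L × ℕ → Option (Entry V)} {l : L} {k j : ℕ}
    (hj : j ≤ k) (e : Option (Entry V)) (hd : data' = Function.update s.data (l, k) e) :
    ({ s with data := data' } : Shared L V T).mismatches j ⊆ s.mismatches j := by
  rintro ⟨l', u⟩ ⟨hr, hm⟩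
  refine ⟨hr, ?_⟩
  simpa only [hd, mvRead_update_of_le _ _ _ hj] using hm

theorem ThreadStep.validationIdx_le_or_checks (h : ThreadStep vm storage block t s p s' p')
    {j : ℕ} (hj : s.validationIdx ≤ j) (i : ℕ) (B : Set (L × Option Version)) :
    s'.validationIdx ≤ j ∨ p'.checks (j, i) B := by
  cases h with
  | val_fetch => exact (Nat.lt_or_eq_of_le hj).imp id id
  | fin_decrease_val | val_decrease_val => exact .inl ((min_le_left _ _).trans hj)
  | _ => exact .inl hj

theorem ThreadStep.lowers (h : ThreadStep vm storage block t s p s' p') {j : ℕ}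
    (hp : p.lowers s.lastWritten j) : s'.validationIdx ≤ j ∨ p'.lowers s'.lastWritten j := by
  cases h with
  | fin_check_new => exact .inr hp.1
  | fin_check_task v w h hw => exact absurd hp.2 hw
  | fin_check_small v w h => exact .inl ((not_lt.1 h).trans hp.1)
  | fin_decrease_val v => exact .inl ((min_le_right _ _).trans hp)
  | val_decrease_val v => exact .inl ((min_le_right _ _).trans hp)
  | _ => first | exact hp.elim | exact .inr hp

theorem ThreadStep.lastWritten (h : ThreadStep vm storage block t s p s' p') (k : ℕ) :
    s'.lastWritten k = s.lastWritten k ∨ p.holds k := by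
  cases h with
  | remove_end v =>
    by_cases hk : k = v.1
    · exact .inr hk.symm
    · exact .inl (by simp [hk])
  | _ => exact .inl rfl

/-- A transaction that is executed after a step was executed before, unless the thread that
executed it is about to see that it gets validated. -/
theorem OwnInv.executed_or_checks (hi : OwnInv vm storage block H owner s pc)
    (h : ThreadStep vm storage block t s (pc t) s' p') {j i : ℕ}
    (hs : s'.txnStatus j = (i, .executed)) (B : Set (L × Option Version)) :
    s.txnStatus j = (i, .executed) ∨ p'.checks (j, i) B := by
  have hold : ∀ j, (pc t).holds j → HolderInv vm storage block H (pc t) j (s.view j) :=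
    fun _ => hi.holder
  generalize pc t = p at h hold
  cases h with
  | fin_status v =>
    by_cases hj : j = v.1
    · subst hj
      have hx : s.txnStatus v.1 = (v.2, .executing) := (hold v.1 rfl).1
      simp only [Function.update_self, hx, Prod.mk.injEq, and_true] at hs
      exact .inr (Prod.ext rfl hs)
    · exact .inl (by simpa [hj] using hs)
  | dep_abort v | val_abort v | val_incarnate v | val_set_ready v =>
    by_cases hj : j = v.1
    · subst hj; simp at hs
    · exact .inl (by simpa [hj] using hs)
  | exec_incarnate k | resume_ready _ _ _ _ k =>
    by_cases hj : j = k
    · subst hj; simp at hs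
    · exact .inl (by simpa [hj] using hs)
  | _ => exact .inl hs

/-- A step makes further reads of an executed transaction fail only if its thread is going to
lower `validationIdx`: replacing or removing an estimate does no harm. -/
theorem OwnInv.mismatches_step (hi : OwnInv vm storage block H owner s pc)
    (h : ThreadStep vm storage block t s (pc t) s' p') {j : ℕ}
    (hs : (s.txnStatus j).2 = .executed) :
    s'.mismatches j ⊆ s.mismatches j ∨ p'.lowers s'.lastWritten j := by
  have hold : ∀ j, (pc t).holds j → HolderInv vm storage block H (pc t) j (s.view j) :=
    fun _ => hi.holder
  generalize pc t = p at h hold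
  cases h with
  | apply_write v rs ws todo l x hl hx =>
    rcases le_or_gt j v.1 with hj | hj
    · exact .inl (mismatches_update_of_le hj _ rfl)
    · by_cases hW : l ∈ s.lastWritten v.1
      · exact .inl (mismatches_update_estimate
          ((((hold v.1 rfl).2.2.2 l).2.2 (.inr hl)).1 hW) _ rfl j)
      · exact .inr ⟨hj.le, l, by simp [hx], hW⟩
  | remove_old v rs ws prev todo l hl =>
    obtain ⟨-, -, -, -, hc⟩ := hold v.1 rfl
    have hw : ws l = none := by by_contra h; exact ((hc l).1 h).1 hl
    exact .inl (mismatches_update_estimate (((hc l).2 hw).1 hl) _ rfl j)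
  | convert_one v todo l hl =>
    rcases le_or_gt j v.1 with hj | hj
    · exact .inl (mismatches_update_of_le hj _ rfl)
    · exact .inr hj
  | store_reads v rs w =>
    by_cases hj : j = v.1
    · subst hj
      have hx : s.txnStatus v.1 = (v.2, .executing) := (hold v.1 rfl).1
      rw [hx] at hs; cases hs
    · refine .inl fun a ha => ⟨?_, ha.2⟩
      simpa [hj] using ha.1
  | _ => exact .inl fun a ha => ha

theorem ThreadStep.checks (h : ThreadStep vm storage block t s p s' p')
    (hd : s.doneMarker = true → p.quiet block.length) {j i : ℕ} (hj : j < block.length)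
    (hs : s'.txnStatus j = (i, .executed)) (hp : p.checks (j, i) (s'.mismatches j)) :
    s'.validationIdx ≤ j ∨ p'.lowers s'.lastWritten j ∨ s'.mismatches j = ∅ ∨
      p'.checks (j, i) (s'.mismatches j) := by
  cases h with
  | loop_done task h =>
    rcases task with _ | v | v
    · exact hp.elim
    · exact hp.elim
    · exact absurd trivial (hd h)
  | loop_execution | loop_none => exact hp.elim
  | fin_check_new v => cases hp; exact .inr (.inl le_rfl)
  | fin_check_small v w h => cases hp; exact .inl (not_lt.1 h)
  | val_load v => cases hp; exact .inr (.inr (.inr ⟨rfl, fun a ha => ha.1⟩))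
  | val_read_match v todo l u hl h =>
    obtain ⟨rfl, hB⟩ := hp
    refine .inr (.inr (.inr ⟨rfl, fun a ha => ⟨hB ha, ?_⟩⟩))
    rintro rfl
    exact ha.2 h
  | val_read_mismatch v => exact .inr (.inr (.inr hp.1))
  | val_read_end v => exact .inr (.inr (.inl (Set.subset_empty_iff.1 hp.2)))
  | val_abort v h => cases hp; simp at hs
  | val_no_abort v h => cases hp; exact absurd hs h
  | val_status k i' hb h =>
    cases hp
    rw [h] at hs; cases hs
    exact .inr (.inr (.inr rfl))
  | val_status_none k h =>
    cases hp
    exact absurd ⟨hj, by rw [hs]⟩ h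
  | _ => first | exact hp.elim | exact .inr (.inr (.inr hp))

variable [DecidableEq T]

theorem Covered.step {j : ℕ} (hc : Covered s pc j) (hi : OwnInv vm storage block H owner s pc)
    (h : ThreadStep vm storage block t s (pc t) s' p') (i : ℕ) (B : Set (L × Option Version)) :
    Covered s' (Function.update pc t p') j ∨ p'.checks (j, i) B := by
  have hp : ∀ {P : PC L V C → Prop}, P p' → ∃ u, P (Function.update pc t p' u) := fun hp =>
    ⟨t, by simpa using hp⟩
  rcases hc with hv | ⟨u, hu⟩
  · exact (h.validationIdx_le_or_checks hv i B).imp_left .inl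
  · by_cases hut : u = t
    · subst hut; exact .inl ((h.lowers hu).imp_right fun h => hp (P := (PC.lowers _ · j)) h)
    · refine .inl (.inr ⟨u, ?_⟩)
      rw [Function.update_of_ne hut]
      cases hq : pc u with
      | applyWrites v rs ws todo =>
        have hW : s'.lastWritten v.1 = s.lastWritten v.1 := by
          refine (h.lastWritten v.1).resolve_right fun ht => hut ?_
          have h1 := hi.thread t v.1 ht
          have h2 := hi.thread u v.1 (by rw [hq]; rfl)
          rw [h1] at h2; cases h2; rfl
        rw [hq] at hu
        exact ⟨hu.1, by rw [hW]; exact hu.2⟩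
      | _ => rw [hq] at hu; exact hu

theorem ValInv.step (hv : ValInv block.length s pc) (hi : OwnInv vm storage block H owner s pc)
    (hd : s.doneMarker = true → (pc t).quiet block.length)
    (h : ThreadStep vm storage block t s (pc t) s' p') :
    ValInv block.length s' (Function.update pc t p') := by
  intro j hj i hs
  have hp : ∀ {P : PC L V C → Prop}, P p' → ∃ u, P (Function.update pc t p' u) := fun hp =>
    ⟨t, by simpa using hp⟩
  have hchecks : p'.checks (j, i) (s'.mismatches j) →
      ∃ u, (Function.update pc t p' u).checks (j, i) (s'.mismatches j) :=
    fun h => hp (P := (PC.checks · _ _)) h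
  have hlowers : p'.lowers s'.lastWritten j → Covered s' (Function.update pc t p') j :=
    fun h => .inr (hp (P := (PC.lowers _ · _)) h)
  rcases hi.executed_or_checks h hs (s'.mismatches j) with hs0 | hc
  · rcases hi.mismatches_step h (j := j) (by rw [hs0]) with hB | hl
    · rcases hv j hj i hs0 with h0 | hc | ⟨u, hu⟩
      · exact .inl (Set.subset_empty_iff.1 (h0 ▸ hB))
      · exact .inr ((hc.step hi h i (s'.mismatches j)).imp_right hchecks)
      · have hu := PC.checks_mono hu hB
        by_cases hut : u = t
        · subst hut
          rcases h.checks hd hj hs hu with h1 | h1 | h1 | h1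
          · exact .inr (.inl (.inl h1))
          · exact .inr (.inl (hlowers h1))
          · exact .inl h1
          · exact .inr (.inr (hchecks h1))
        · exact .inr (.inr ⟨u, by rwa [Function.update_of_ne hut]⟩)
    · exact .inr (.inl (hlowers hl))
  · exact .inr (.inr (hchecks hc))

end BlockSTM

namespace BlockSTM

variable {L V C T : Type*}

/-! ### The memory below a transaction -/

/-- The memory that transaction `j` reads: the values of the transactions below it. -/
def memory (data : L × ℕ → Option (Entry V)) (j : ℕ) (l : L) : Option V :=
  match mvRead data l j with
  | .ok _ x => some x
  | _ => none

theorem memory_eq_some {data : L × ℕ → Option (Entry V)} {j : ℕ} {l : L} {x : V} :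
    memory data j l = some x ↔ ∃ u, mvRead data l j = .ok u x := by
  unfold memory
  split
  · rename_i u y h; simp [h]
  · rename_i h; simpa using fun v w hu => h _ _ hu

/-- A thread that is responsible for a transaction has a task. -/
theorem PC.not_quiet_of_holds {n j : ℕ} {p : PC L V C} (h : p.holds j) : ¬ p.quiet n := by
  cases p with
  | loop task =>
    rcases task with _ | v | v
    · exact h.elim
    · exact fun hq => hq trivial
    · exact h.elim
  | _ => first | exact h.elim | exact fun hq => hq trivial

theorem ValInv.mismatches_of_quiet {n j : ℕ} {s : Shared L V T} {pc : T → PC L V C}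
    (hv : ValInv n s pc) (hq : Quiet n s pc) (hj : j < n)
    (hs : (s.txnStatus j).2 = .executed) : s.mismatches j = ∅ := by
  rcases hv j hj (s.txnStatus j).1 (Prod.ext rfl hs) with h | (h | ⟨t, ht⟩) | ⟨t, ht⟩
  · exact h
  · exact absurd (hq.val.trans h) (not_le.2 hj)
  · exfalso
    have h1 := hq.quiet t
    generalize pc t = p at ht h1
    cases p <;> first | exact ht.elim | exact h1 trivial
  · exfalso
    have h1 := hq.quiet t
    generalize pc t = p at ht h1
    cases p with
    | loop task =>
      rcases task with _ | v | v
      · exact ht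
      · exact ht
      · exact h1 trivial
    | valStatus k => cases ht; exact absurd h1 (not_le.2 hj)
    | _ => first | exact ht.elim | exact h1 trivial

/-! ### Snapshots -/

/-- What the caller of `snapshot` has collected, after a call in a state in which no thread has a
task. -/
def ClientInv (n : ℕ) (s : Shared L V T) (pc : T → PC L V C) : Client L V → Prop
  | .idle => True
  | .running todo ret => Quiet n s pc ∧ todo.Finite ∧
      ret = {a | a.1 ∉ todo ∧ memory s.data n a.1 = some a.2}
  | .returned ret => Quiet n s pc ∧ ret = {a | memory s.data n a.1 = some a.2}

theorem DoneInv.quiet_of_joined {n : ℕ} {t : T} {s : Shared L V T} {pc : T → PC L V C}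
    (hi : DoneInv n s pc) (ht : pc t = .joined) :
    Quiet n s pc := by
  have := hi.check t
  rw [ht] at this
  exact hi.done this

theorem ClientInv.step {n : ℕ} {s s' : State L V C T} (hd : DoneInv n s.shared s.pc)
    (hf : {a | s.shared.data a ≠ none}.Finite) (hc : ClientInv n s.shared s.pc s.client)
    (h : ClientStep n s s') :
    s'.shared = s.shared ∧ s'.pc = s.pc ∧ ClientInv n s.shared s.pc s'.client := by
  cases h with
  | call t ht h =>
    refine ⟨rfl, rfl, hd.quiet_of_joined ht, (hf.image Prod.fst).subset ?_, ?_⟩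
    · rintro l ⟨i, hl⟩; exact ⟨(l, i), hl, rfl⟩
    · refine (Set.eq_empty_of_forall_notMem ?_).symm
      rintro ⟨l, x⟩ ⟨hl, hx⟩
      obtain ⟨u, hu⟩ := memory_eq_some.1 hx
      exact hl ⟨u.1, by simp [(mvRead_eq_ok hu).2]⟩
  | collect todo ret l u x h hl hr =>
    rw [h] at hc
    obtain ⟨hq, htodo, rfl⟩ := hc
    refine ⟨rfl, rfl, hq, htodo.subset Set.sdiff_subset, ?_⟩
    have hx : memory s.shared.data n l = some x := memory_eq_some.2 ⟨u, hr⟩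
    ext ⟨l', y⟩
    by_cases hl' : l' = l
    · subst hl'; simp [hx, hl, eq_comm]
    · simp [hl']
  | skip todo ret l h hl hr =>
    rw [h] at hc
    obtain ⟨hq, htodo, rfl⟩ := hc
    refine ⟨rfl, rfl, hq, htodo.subset Set.sdiff_subset, ?_⟩
    have hx : ∀ x, memory s.shared.data n l ≠ some x := fun x hx => by
      obtain ⟨u, hu⟩ := memory_eq_some.1 hx
      exact hr u x hu
    ext ⟨l', y⟩
    by_cases hl' : l' = l
    · subst hl'; simp [hx, hl]
    · simp [hl']
  | finish ret h =>
    rw [h] at hc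
    exact ⟨rfl, rfl, hc.1, by simpa using hc.2.2⟩

/-- The caller of `snapshot` can process the finitely many remaining locations. -/
theorem ClientStep.exists_returned (n : ℕ) {todo : Set L} (hf : todo.Finite)
    (s : State L V C T) (ret : Set (L × V)) (h : s.client = .running todo ret) :
    ∃ s' ret', Relation.ReflTransGen (ClientStep n) s s' ∧ s'.client = .returned ret' := by
  induction hk : todo.ncard generalizing todo s ret with
  | zero =>
    rw [Set.ncard_eq_zero hf] at hk
    subst hk
    exact ⟨_, ret, .single (.finish s ret h), rfl⟩
  | succ k ih =>
    obtain ⟨l, hl⟩ : todo.Nonempty := by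
      rw [Set.nonempty_iff_ne_empty]; rintro rfl; simp at hk
    have hk' : (todo \ {l}).ncard = k := by
      have := Set.ncard_sdiff_singleton_add_one hl hf; omega
    by_cases hr : ∃ u x, mvRead s.shared.data l n = .ok u x
    · obtain ⟨u, x, hr⟩ := hr
      obtain ⟨s', ret', h1, h2⟩ := ih (hf.subset Set.sdiff_subset)
        { s with client := .running (todo \ {l}) (ret ∪ {(l, x)}) } _ rfl hk'
      exact ⟨s', ret', h1.head (.collect s todo ret l u x h hl hr), h2⟩
    · push Not at hr
      obtain ⟨s', ret', h1, h2⟩ := ih (hf.subset Set.sdiff_subset)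
        { s with client := .running (todo \ {l}) ret } _ rfl hk'
      exact ⟨s', ret', h1.head (.skip s todo ret l h hl hr), h2⟩

/-! ### The state when no thread has a task -/

variable [DecidableEq L] {vm : C → Op L V C} {storage : L → V} {block : List C}
  {t : T} {s s' : Shared L V T} {p p' : PC L V C} {pc : T → PC L V C} {H : History L V}
  {owner : ℕ → Option (T ⊕ ℕ)}

/-- When no thread has a task, every transaction is executed. -/
theorem OwnInv.executed_of_quiet (hi : OwnInv vm storage block H owner s pc)
    (he : ExecInv block.length s pc) (hq : Quiet block.length s pc) (j : ℕ)
    (hj : j < block.length) : (s.txnStatus j).2 = .executed := by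
  induction j using Nat.strong_induction_on with
  | _ j ih =>
  have hx := hi.tx j
  rcases ho : owner j with _ | t | b
  · rw [ho] at hx
    rcases hx with ⟨hs, -, -⟩ | ⟨hs, -, -⟩
    · exfalso
      rcases he.ready j hj hs with h | ⟨t, ht⟩
      · exact absurd (hq.exec.trans h) (not_le.2 hj)
      · have h1 := hq.quiet t
        generalize pc t = p at ht h1
        cases p <;> first | exact ht.elim | exact h1 trivial | skip
        cases ht; exact absurd h1 (not_le.2 hj)
    · exact hs
  · rw [ho] at hx
    exact absurd (hq.quiet t) (PC.not_quiet_of_holds hx.1)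
  · -- A transaction that waits for a smaller one would be resumed after the latter is executed.
    rw [ho] at hx
    exfalso
    have hb := he.dep_lt b j hx.1
    rcases he.blocked b (.inl ⟨j, hx.1⟩) with h | ⟨t, ht⟩
    · exact h (ih b hb (hb.trans hj))
    · have h1 := hq.quiet t
      generalize pc t = p at ht h1
      cases p <;> first | exact ht.elim | exact h1 trivial

/-- When no thread has a task, the values of each transaction are those that it writes if it is run
on the memory left by the transactions below it. -/
theorem OwnInv.exec_of_quiet (hi : OwnInv vm storage block H owner s pc)
    (he : ExecInv block.length s pc) (hv : ValInv block.length s pc)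
    (hq : Quiet block.length s pc) {j : ℕ} {c : C} (hc : block[j]? = some c) :
    Exec vm storage c (memory s.data j) (memory s.data (j + 1)) := by
  have hj : j < block.length := (List.getElem?_eq_some_iff.1 hc).1
  have hs := hi.executed_of_quiet he hq j hj
  have hm := hv.mismatches_of_quiet hq hj hs
  have hx := hi.tx j
  rw [hi.owner_eq_none (.inr hs)] at hx
  rcases hx with ⟨hs', -, -⟩ | ⟨-, hcur, hf⟩
  · have hs' : (s.txnStatus j).2 = .readyToExecute := hs'
    rw [hs'] at hs; cases hs
  have hreads : ReadsFrom H (s.lastRead j) (memory s.data j) := by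
    intro l u hu
    have hmatch : readMatches u (mvRead s.data l j) := by
      by_contra h
      have : (l, u) ∈ s.mismatches j := ⟨hu, h⟩
      rw [hm] at this; exact this
    unfold memory
    cases hr : mvRead s.data l j with
    | notFound => rw [hr] at hmatch; cases hmatch; rfl
    | readError b => rw [hr] at hmatch; exact hmatch.elim
    | ok v x =>
      rw [hr] at hmatch; cases hmatch
      exact (hi.hist _ _ _ _ (mvRead_eq_ok hr).2).symm
  convert hf.2 c hc _ hreads using 1
  funext l
  have hl : s.data (l, j) = (H j (s.txnStatus j).1 l).map (.value (s.txnStatus j).1) := hcur.2 l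
  change _ = overlay (H j (s.txnStatus j).1) _ l
  unfold overlay
  conv_lhs => unfold memory
  rw [mvRead, hl]
  cases H j (s.txnStatus j).1 l <;> rfl

/-- Memories `mem 0`, `mem 1`, … such that each transaction leads from one to the next give the
sequential run. -/
theorem SeqRun.of_exec {mem : ℕ → L → Option V}
    (h : ∀ j c, block[j]? = some c → Exec vm storage c (mem j) (mem (j + 1))) :
    SeqRun vm storage block (mem 0) (mem block.length) := by
  induction block generalizing mem with
  | nil => exact .nil _
  | cons c cs ih =>
    refine .cons c cs _ (mem 1) _ (h 0 c rfl) ?_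
    exact ih (mem := fun j => mem (j + 1)) fun j c' hc => h (j + 1) c' hc

/-! ### The invariant of concurrent runs -/

/-- The invariant of the shared state and the threads. -/
structure Inv (vm : C → Op L V C) (storage : L → V) (block : List C) (s : Shared L V T)
    (pc : T → PC L V C) : Prop where
  done : DoneInv block.length s pc
  own : Owned vm storage block s pc
  exec : ExecInv block.length s pc
  val : ValInv block.length s pc
  finite : {a | s.data a ≠ none}.Finite

theorem Inv.seqRun (hi : Inv vm storage block s pc) (hq : Quiet block.length s pc) :
    SeqRun vm storage block (fun _ => none) (memory s.data block.length) := by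
  obtain ⟨H, owner, ho⟩ := hi.own
  exact SeqRun.of_exec (mem := memory s.data) fun j c hc =>
    ho.exec_of_quiet hi.exec hi.val hq hc

theorem Inv.init (vm : C → Op L V C) (storage : L → V) (block : List C) :
    Inv vm storage block (Shared.init L V T) (fun _ => .loop none) where
  done := ⟨⟨∅, fun _ => by simp [PC.active], rfl⟩, fun _ => trivial, fun h => by cases h⟩
  own := by
    refine ⟨fun _ _ _ => none, fun _ => none, fun _ _ h => h.elim, fun _ _ h => h.elim, fun j => ?_,
      fun j l i y h => (by cases h), fun _ _ _ => rfl⟩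
    exact .ready rfl (fun l => ⟨fun h => h.elim, fun _ => rfl⟩) rfl
  exec := ⟨fun j _ _ => .inl (Nat.zero_le j), fun _ _ h => h.elim, fun _ _ _ h => h.elim,
    fun _ _ h => h.elim, fun b _ => .inl (by simp [Shared.init])⟩
  val := fun j _ i h => by cases h
  finite := by simp [Shared.init]

theorem ThreadStep.data_finite (h : ThreadStep vm storage block t s p s' p')
    (hf : {a | s.data a ≠ none}.Finite) : {a | s'.data a ≠ none}.Finite := by
  have key : ∀ (a : L × ℕ) (e : Option (Entry V)),
      {b | Function.update s.data a e b ≠ none}.Finite := by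
    refine fun a e => (hf.insert a).subset fun b hb => ?_
    by_cases hab : b = a
    · exact .inl hab
    · exact .inr (by simpa [hab] using hb)
  cases h <;> first | exact hf | exact key _ _

variable [DecidableEq T]

theorem Inv.step (hi : Inv vm storage block s pc)
    (h : ThreadStep vm storage block t s (pc t) s' p') :
    Inv vm storage block s' (Function.update pc t p') := by
  obtain ⟨H, owner, ho⟩ := hi.own
  have hd : s.doneMarker = true → (pc t).quiet block.length := fun hd => (hi.done.done hd).quiet t
  refine ⟨hi.done.step h, ho.step hd h, hi.exec.step ?_ h, hi.val.step ho hd h,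
    h.data_finite hi.finite⟩
  intro v w deps todo hp j hj
  have hx := ho.holder (t := t) (j := j) (by rw [hp]; exact hj)
  rw [hp] at hx
  exact hx.2.2

theorem Inv.reachable {s : State L V C T} (hs : Reachable vm storage block s) :
    Inv vm storage block s.shared s.pc ∧ ClientInv block.length s.shared s.pc s.client := by
  induction hs with
  | refl => exact ⟨.init vm storage block, trivial⟩
  | tail _ hstep ih =>
    obtain ⟨hi, hc⟩ := ih
    cases hstep with
    | thread t sh p h =>
      refine ⟨hi.step h, ?_⟩
      dsimp only
      rename_i s _
      cases hcl : s.client with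
      | idle => trivial
      | running todo ret =>
        rw [hcl] at hc
        obtain ⟨hq, hd⟩ := hc.1.step h
        exact ⟨hq, hc.2.1, by rw [hd]; exact hc.2.2⟩
      | returned ret =>
        rw [hcl] at hc
        obtain ⟨hq, hd⟩ := hc.1.step h
        exact ⟨hq, by rw [hd]; exact hc.2⟩
    | client _ h =>
      obtain ⟨hsh, hpc, hc'⟩ := hc.step hi.done hi.finite h
      rw [hsh, hpc]
      exact ⟨hi, hc'⟩

end BlockSTM

theorem mainTheorem1 {L V C T : Type*} [DecidableEq L] [DecidableEq T]
    (vm : C → BlockSTM.Op L V C) (storage : L → V) (block : List C)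
    (s : BlockSTM.State L V C T) (hs : BlockSTM.Reachable vm storage block s)
    (hjoin : ∃ t, s.pc t = .joined) :
    ∃ M : L → Option V,
      BlockSTM.SeqRun vm storage block (fun _ => none) M ∧
      (∀ ret : Set (L × V), s.client = .returned ret → ret = {p | M p.1 = some p.2}) ∧
      ∃ s' : BlockSTM.State L V C T,
        Relation.ReflTransGen (BlockSTM.ClientStep block.length) s s' ∧
        s'.client = .returned {p | M p.1 = some p.2} := by
  obtain ⟨t, ht⟩ := hjoin
  obtain ⟨hi, hc⟩ := BlockSTM.Inv.reachable hs
  have hq := hi.done.quiet_of_joined ht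
  -- A snapshot that is returned later is returned in a reachable state, with the same memory.
  have key : ∀ s' : BlockSTM.State L V C T,
      Relation.ReflTransGen (BlockSTM.ClientStep block.length) s s' →
      s'.shared = s.shared ∧ s'.pc = s.pc ∧
        BlockSTM.ClientInv block.length s.shared s.pc s'.client := by
    intro s' h
    induction h with
    | refl => exact ⟨rfl, rfl, hc⟩
    | tail _ h ih =>
      obtain ⟨hsh, hpc, hc'⟩ := ih
      rw [← hsh, ← hpc] at hi hc' ⊢
      exact hc'.step hi.done hi.finite h
  have hret : ∀ (s' : BlockSTM.State L V C T) (ret : Set (L × V)),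
      Relation.ReflTransGen (BlockSTM.ClientStep block.length) s s' →
      s'.client = .returned ret →
      ret = {p | BlockSTM.memory s.shared.data block.length p.1 = some p.2} := by
    intro s' ret h hr
    have := (key s' h).2.2
    rw [hr] at this
    exact this.2
  refine ⟨_, hi.seqRun hq, fun ret h => hret s ret .refl h, ?_⟩
  have hrun : ∃ s' ret, Relation.ReflTransGen (BlockSTM.ClientStep block.length) s s' ∧
      s'.client = .returned ret := by
    cases hcl : s.client with
    | idle =>
      have hstep := BlockSTM.ClientStep.call (n := block.length) s t ht hcl
      obtain ⟨s', ret, h1, h2⟩ := BlockSTM.ClientStep.exists_returned block.length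
        (hc.step hi.done hi.finite hstep).2.2.2.1
        { s with client := .running {l | ∃ i, s.shared.data (l, i) ≠ none} ∅ } ∅ rfl
      exact ⟨s', ret, h1.head hstep, h2⟩
    | running todo ret =>
      rw [hcl] at hc
      exact BlockSTM.ClientStep.exists_returned block.length hc.2.1 s ret hcl
    | returned ret => exact ⟨s, ret, .refl, hcl⟩
  obtain ⟨s', ret, h1, h2⟩ := hrun
  exact ⟨s', h1, by rw [h2, hret s' ret h1 h2]⟩
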